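/- **Problem.** Let $G=(V,E)$ be a finite undirected graph with edge costs $c:E\to\mathbb R_{\ge 0}$ and edge priorities $\mathrm{pr}:E\to[b]$. A request is a terminal pair $(s,t)\in V\times V$ with a priority in $[b]$. In online priority Steiner forest the requests $R=(r_1,\dots,r_{|R|})$ arrive one at a time, and a growing edge set $S\subseteq E$ must be maintained in which the terminals of every request that has arrived are connected by a path of edges of at least the priority of that request. Assume that all requests can be satisfied in $G$; $\mathrm{OPT}$ is the minimum cost of an edge set that is feasible for $R$. A prediction $\hat R$ (a list of requests) is given in advance. $R_j,\hat R_j$ are the parts of $R,\hat R$ of priority $j$, and $G_j$ is the subgraph of the edges of priority at least $j$. For edge costs $c$ and a set $F$ of free edges, $P^F_{u,v}$ is a shortest path from $u$ to $v$ when the edges in $F$ cost $0$, and $c(P^F_{u,v})$ is its length in these costs. **Error.** The matching cost of $(s_1,t_1)$ and $(s_2,t_2)$ is infinite if their priorities differ, and $\min\{d_j(s_1,s_2)+d_j(t_1,t_2),\,d_j(s_1,t_2)+d_j(s_2,t_1)\}$ if both have priority $j$, where $d_j$ is the shortest-path distance in $G_j$. A pair $(\Delta,D)$ with $\Delta\in\mathbb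 N$ and $0\le D<\infty$ is an *error* of $\hat R$ for $R$ if there are $M\subseteq R$, $\hat M\subseteq\hat R$ with $|M|=|\hat M|$ such that the minimum cost of a perfect matching between $M$ and $\hat M$ is $D$, and $|R\setminus M|+|\hat R\setminus\hat M|=\Delta$. **Online Steiner forest algorithm $\mathrm{ON}$** (Berman–Coulston). An instance on a graph with given costs keeps bought edges $F$ and, for every $\ell\in\mathbb Z$, a collection $D_\ell$ of open balls of radius $2^{\ell-2}$, all initially empty. Upon $(s,t)$, let $P=P^F_{s,t}$ and $x=c(P)$, and add $P$ to $F$. If $x>0$, let $\ell=\lfloor\log_2 x\rfloor$. If for some $v\in\{s,t\}$ the ball of radius $2^{\ell-2}$ around $v$ intersects no ball in $D_\ell$ (two balls intersect if the distance of their centers in the costs of the instance, without discount for $F$, is less than the sum of the radii), add that ball to $D_\ell$. Otherwise choose balls in $D_\ell$, with centers $a_1$ and $a_2$, that intersect the balls around $s$ and $t$ respectively, and add $P^F_{a_1,s}$ and $P^F_{a_2,t}$ to $F$. The cost incurred is the cost of the newly bought edges. **Offline component.** $\mathrm{PC}$ is a $\gamma$-approximation algorithm for prize-collecting Steiner forest,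 where $\gamma\ge1$ is a constant: for every graph, costs, and list of terminal pairs with penalties, it returns an edge set whose cost plus the penalties of the pairs it does not connect is at most $\gamma$ times the minimum. (For instance $\gamma=2.54$, as achieved by Hajiaghayi and Jain.) For a list $\hat Q$ of pairs and $u\in\mathbb N$, $\mathrm{Partial}(\hat Q,u)$ is defined as follows. If $\gamma u\ge|\hat Q|$, return $\emptyset$. Otherwise let $T_i$ be the output of $\mathrm{PC}$ on $\hat Q$ when every pair has penalty $2^i$, let $n_i$ be the number of pairs of $\hat Q$ not connected by $T_i$, and let $i$ be the least integer with $n_i\le\gamma u$; return $T_{i-1}$ if $\gamma u\ge(n_{i-1}+n_i)/2$, and $T_i$ otherwise. (If no integer $i$ qualifies, there is no result; if some qualify but there is no least one, return a $T_i$ with $n_i\le\gamma u$ and $c(T_i)=0$.) **Steiner forest with predictions** (graph $H$, costs $c$, prediction $\hat Q$). Initially $B=\hat B=0$ and $S=\emptyset$, and a fresh instance of $\mathrm{ON}$ is started on $H$ with costs $c$. Upon each request, send it to the current instance of $\mathrm{ON}$, add the edges it buys to $S$, and add the cost it incurs to $B$. Then, if $B\ge2\hat B$: set $\hat B=B$,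 let $u$ be the least number for which $\mathrm{Partial}(\hat Q,u)$ has a result of cost at most $3\gamma\hat B$, add that result to $S$, and start a new instance of $\mathrm{ON}$ on $H$ in which all edges of $S$ have cost $0$ (and all other edges their cost $c$). **Priority Steiner forest with predictions.** Run $b$ parallel instances of the preceding algorithm, the $j$-th on $G_j$ with prediction $\hat R_j$; send each request of priority $j$ to the $j$-th instance; maintain the union of the solutions of all $b$ instances. **Theorem.** For every $\gamma\ge1$ there is a constant $C>0$, depending only on $\gamma$, such that for all $b$, $G$, $c$, $\mathrm{pr}$, all $\gamma$-approximation algorithms $\mathrm{PC}$, all predictions $\hat R$ and all satisfiable request sequences $R$, the algorithm for priority Steiner forest with predictions can always be carried out, and, however ties and arbitrary choices are resolved, its final solution is feasible and its cost $\mathrm{ALG}$ satisfies, for every error $(\Delta,D)$ of $\hat R$ for $R$ simultaneously, $$\mathrm{ALG}\le C\,b\log\Bigl(\frac{\min\{|R|,\Delta\}}{b}+2\Bigr)\cdot\mathrm{OPT}+C\cdot D .$$ -/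

import Mathlib

open scoped NNReal ENNReal

noncomputable section

namespace PSF

/-! ### Weighted graphs

A graph is a `SimpleGraph V` on a finite vertex type, with non-negative edge costs
`c : Sym2 V → ℝ≥0` (only the values on edges of the graph matter). -/

/-- Total cost of a set of edges. -/
def cost {V : Type*} (c : Sym2 V → ℝ≥0) (S : Finset (Sym2 V)) : ℝ≥0 := ∑ e ∈ S, c e

/-- The cost function `c` with the cost of the edges of `S` set to zero. -/
def freeOn {V : Type*} [DecidableEq V] (c : Sym2 V → ℝ≥0) (S : Finset (Sym2 V)) :
    Sym2 V → ℝ≥0 :=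
  fun e => if e ∈ S then 0 else c e

/-- Cost of a walk. -/
def walkCost {V : Type*} {G : SimpleGraph V} (c : Sym2 V → ℝ≥0) {u v : V} (p : G.Walk u v) :
    ℝ≥0 :=
  (p.edges.map c).sum

/-- `p` is a shortest path between its end points with respect to `c`. -/
def IsShortest {V : Type*} {G : SimpleGraph V} (c : Sym2 V → ℝ≥0) {u v : V}
    (p : G.Walk u v) : Prop :=
  p.IsPath ∧ ∀ q : G.Walk u v, walkCost c p ≤ walkCost c q

/-- Shortest-path distance; it is `⊤` between vertices in different components. -/
def gdist {V : Type*} (G : SimpleGraph V) (c : Sym2 V → ℝ≥0) (u v : V) : ℝ≥0∞ :=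
  ⨅ p : G.Walk u v, (walkCost c p : ℝ≥0∞)

/-- The edges of `S` connect `s` and `t`. -/
def Connects {V : Type*} (S : Set (Sym2 V)) (s t : V) : Prop :=
  (SimpleGraph.fromEdgeSet S).Reachable s t

/-! ### Prize-collecting Steiner forest -/

open Classical in
/-- Objective of prize-collecting Steiner forest: the cost of the chosen edges plus the penalties
of the terminal pairs which they do not connect. An instance lists the terminal pairs with
their penalties. -/
def pcCost {V : Type*} (c : Sym2 V → ℝ≥0) (L : List ((V × V) × ℝ≥0)) (T : Finset (Sym2 V)) :
    ℝ≥0 :=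
  cost c T + ((L.filter fun x => ¬ Connects (T : Set (Sym2 V)) x.1.1 x.1.2).map Prod.snd).sum

/-- An offline algorithm for prize-collecting Steiner forest: it maps a graph, edge costs, and a
list of terminal pairs with penalties to a set of edges. -/
abbrev PCAlgorithm (V : Type*) :=
  SimpleGraph V → (Sym2 V → ℝ≥0) → List ((V × V) × ℝ≥0) → Finset (Sym2 V)

/-- `PC` is a `γ`-approximation algorithm for prize-collecting Steiner forest. -/
def IsPCApprox {V : Type*} (γ : ℝ≥0) (PC : PCAlgorithm V) : Prop :=
  ∀ (G : SimpleGraph V) (c : Sym2 V → ℝ≥0) (L : List ((V × V) × ℝ≥0)),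
    (PC G c L : Set (Sym2 V)) ⊆ G.edgeSet ∧
      ∀ T : Finset (Sym2 V), (T : Set (Sym2 V)) ⊆ G.edgeSet →
        pcCost c L (PC G c L) ≤ γ * pcCost c L T

/-- Approximation algorithms exist for every ratio `γ ≥ 1` (here: exact minimization). -/
theorem exists_isPCApprox {V : Type*} [Fintype V] [DecidableEq V] (γ : ℝ≥0) (hγ : 1 ≤ γ) :
    ∃ PC : PCAlgorithm V, IsPCApprox γ PC := by
  classical
  have key : ∀ (G : SimpleGraph V) (c : Sym2 V → ℝ≥0) (L : List ((V × V) × ℝ≥0)),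
      ∃ S : Finset (Sym2 V), (S : Set (Sym2 V)) ⊆ G.edgeSet ∧
        ∀ T : Finset (Sym2 V), (T : Set (Sym2 V)) ⊆ G.edgeSet → pcCost c L S ≤ pcCost c L T := by
    intro G c L
    obtain ⟨S, hS, hmin⟩ := Finset.exists_min_image
      (Finset.univ.filter fun S : Finset (Sym2 V) => (S : Set (Sym2 V)) ⊆ G.edgeSet)
      (pcCost c L) ⟨∅, by simp⟩
    exact ⟨S, by simpa using hS, fun T hT => hmin T (by simpa using hT)⟩
  choose PC hPC using key
  exact ⟨PC, fun G c L => ⟨(hPC G c L).1, fun T hT =>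
    ((hPC G c L).2 T hT).trans (le_mul_of_one_le_left bot_le hγ)⟩⟩

/-! ### The online algorithm of Berman and Coulston for Steiner forest -/

/-- State of the online algorithm: the edges `F` bought so far, and for every `ℓ` the set of
centers of the balls, all of radius `2 ^ (ℓ - 2)`, of the `ℓ`-th dual collection. -/
structure OnState (V : Type*) where
  F : Finset (Sym2 V)
  duals : ℤ → Finset V

/-- A fresh instance. -/
def OnState.init {V : Type*} : OnState V := ⟨∅, fun _ => ∅⟩

/-- The open balls of radius `2 ^ (ℓ - 2)` around `u` and `v` intersect, that is, their distance
is smaller than the sum of the two radii. -/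
def BallsIntersect {V : Type*} (G : SimpleGraph V) (c : Sym2 V → ℝ≥0) (ℓ : ℤ) (u v : V) : Prop :=
  gdist G c u v < (((2 : ℝ≥0) ^ (ℓ - 2) + (2 : ℝ≥0) ^ (ℓ - 2) : ℝ≥0) : ℝ≥0∞)

/-- The index `⌊log₂ x⌋`. -/
def level (x : ℝ≥0) : ℤ := ⌊Real.logb 2 (x : ℝ)⌋

/-- One step of the online algorithm on the graph `G` with costs `c`, upon the terminal pair
`(s, t)`. All ties and arbitrary choices are resolved arbitrarily. In every case a path `p` from
`s` to `t` is bought which is shortest when the edges in `F` are free. -/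
inductive OnStep {V : Type*} [DecidableEq V] (G : SimpleGraph V) (c : Sym2 V → ℝ≥0) :
    OnState V → V × V → OnState V → Prop
  /-- The path is free (`ℓ = -∞`): nothing else happens. -/
  | free (σ : OnState V) (s t : V) (p : G.Walk s t)
      (hp : IsShortest (freeOn c σ.F) p)
      (h0 : walkCost (freeOn c σ.F) p = 0) :
      OnStep G c σ (s, t) ⟨σ.F ∪ p.edges.toFinset, σ.duals⟩
  /-- The ball around one of the terminals, `v`, intersects no ball of the collection `ℓ`:
  it is added. -/
  | newBall (σ : OnState V) (s t : V) (p : G.Walk s t) (ℓ : ℤ) (v : V)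
      (hp : IsShortest (freeOn c σ.F) p)
      (hpos : 0 < walkCost (freeOn c σ.F) p)
      (hℓ : ℓ = level (walkCost (freeOn c σ.F) p))
      (hv : v = s ∨ v = t)
      (hball : ∀ a ∈ σ.duals ℓ, ¬ BallsIntersect G c ℓ v a) :
      OnStep G c σ (s, t)
        ⟨σ.F ∪ p.edges.toFinset, Function.update σ.duals ℓ (insert v (σ.duals ℓ))⟩
  /-- The balls around both terminals intersect balls of the collection `ℓ`: the terminals are
  connected to the centers `a₁`, `a₂` of arbitrary such balls by shortest paths, the edges
  already bought (including those of `p`) being free. -/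
  | connect (σ : OnState V) (s t : V) (p : G.Walk s t) (ℓ : ℤ)
      (F₁ : Finset (Sym2 V)) (a₁ a₂ : V) (p₁ : G.Walk a₁ s) (p₂ : G.Walk a₂ t)
      (hp : IsShortest (freeOn c σ.F) p)
      (hpos : 0 < walkCost (freeOn c σ.F) p)
      (hℓ : ℓ = level (walkCost (freeOn c σ.F) p))
      (hF₁ : F₁ = σ.F ∪ p.edges.toFinset)
      (ha₁ : a₁ ∈ σ.duals ℓ) (hi₁ : BallsIntersect G c ℓ s a₁)
      (ha₂ : a₂ ∈ σ.duals ℓ) (hi₂ : BallsIntersect G c ℓ t a₂)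
      (hp₁ : IsShortest (freeOn c F₁) p₁) (hp₂ : IsShortest (freeOn c F₁) p₂) :
      OnStep G c σ (s, t) ⟨F₁ ∪ p₁.edges.toFinset ∪ p₂.edges.toFinset, σ.duals⟩

/-! ### The subroutine serving part of the prediction -/

open Classical in
/-- The number of pairs of `Rh` which are not connected by `S`. -/
def unsat {V : Type*} (Rh : List (V × V)) (S : Finset (Sym2 V)) : ℕ :=
  (Rh.filter fun r => ¬ Connects (S : Set (Sym2 V)) r.1 r.2).length

/-- Output of `PC` on the pairs `Rh` when every pair has penalty `2 ^ i`. -/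
def pcSol {V : Type*} (PC : PCAlgorithm V) (G : SimpleGraph V) (c : Sym2 V → ℝ≥0)
    (Rh : List (V × V)) (i : ℤ) : Finset (Sym2 V) :=
  PC G c (Rh.map fun r => (r, (2 : ℝ≥0) ^ i))

/-- The exponents `i` for which the output of `PC` leaves at most `γ * u` pairs unconnected. -/
def goodExponents {V : Type*} (γ : ℝ≥0) (PC : PCAlgorithm V) (G : SimpleGraph V)
    (c : Sym2 V → ℝ≥0) (Rh : List (V × V)) (u : ℕ) : Set ℤ :=
  {i | (unsat Rh (pcSol PC G c Rh i) : ℝ≥0) ≤ γ * u}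

/-- `IsPartial γ PC G c Rh u S`: the call `Partial(Rh, u)` returns `S`.

The call has no result if no exponent is good, which happens only if too many predicted pairs
cannot be connected in `G`. If there are good exponents but no least one (possible only in the
presence of edges of cost zero or of pairs with equal end points), then a good solution of cost
zero is returned. -/
inductive IsPartial {V : Type*} (γ : ℝ≥0) (PC : PCAlgorithm V) (G : SimpleGraph V)
    (c : Sym2 V → ℝ≥0) (Rh : List (V × V)) (u : ℕ) : Finset (Sym2 V) → Prop
  | empty (h : (Rh.length : ℝ≥0) ≤ γ * u) : IsPartial γ PC G c Rh u ∅
  | first (i : ℤ) (h : γ * u < (Rh.length : ℝ≥0))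
      (hi : IsLeast (goodExponents γ PC G c Rh u) i)
      (hu : ((unsat Rh (pcSol PC G c Rh (i - 1)) : ℝ≥0) + unsat Rh (pcSol PC G c Rh i)) / 2
        ≤ γ * u) :
      IsPartial γ PC G c Rh u (pcSol PC G c Rh (i - 1))
  | second (i : ℤ) (h : γ * u < (Rh.length : ℝ≥0))
      (hi : IsLeast (goodExponents γ PC G c Rh u) i)
      (hu : γ * u
        < ((unsat Rh (pcSol PC G c Rh (i - 1)) : ℝ≥0) + unsat Rh (pcSol PC G c Rh i)) / 2) :
      IsPartial γ PC G c Rh u (pcSol PC G c Rh i)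
  | noLeast (i : ℤ) (h : γ * u < (Rh.length : ℝ≥0))
      (hb : ¬ BddBelow (goodExponents γ PC G c Rh u))
      (hi : i ∈ goodExponents γ PC G c Rh u)
      (h0 : cost c (pcSol PC G c Rh i) = 0) :
      IsPartial γ PC G c Rh u (pcSol PC G c Rh i)

/-- `Partial(Rh, u)` returns a solution `S` of cost at most `3 * γ * β`. -/
def PartialWithin {V : Type*} (γ : ℝ≥0) (PC : PCAlgorithm V) (G : SimpleGraph V)
    (c : Sym2 V → ℝ≥0) (Rh : List (V × V)) (β : ℝ≥0) (u : ℕ) (S : Finset (Sym2 V)) : Prop :=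
  IsPartial γ PC G c Rh u S ∧ cost c S ≤ 3 * γ * β

/-! ### Steiner forest with predictions -/

/-- State of the algorithm with predictions: the counters `B` and `Bh`, the solution `S`, the
current instance `on` of the online algorithm, and the set `S₀` of edges whose cost was set to
zero when that instance was started. -/
structure SFState (V : Type*) where
  B : ℝ≥0
  Bh : ℝ≥0
  S : Finset (Sym2 V)
  S₀ : Finset (Sym2 V)
  on : OnState V

/-- Initial state. -/
def SFState.init {V : Type*} : SFState V := ⟨0, 0, ∅, ∅, OnState.init⟩

/-- The value of the counter `B` after the online instance has moved to the state `on'`: it grows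
by the cost of the newly bought edges, in the costs of that instance. -/
def SFState.newB {V : Type*} [DecidableEq V] (c : Sym2 V → ℝ≥0) (σ : SFState V)
    (on' : OnState V) : ℝ≥0 :=
  σ.B + cost (freeOn c σ.S₀) (on'.F \ σ.on.F)

/-- One step of the algorithm for Steiner forest on `G` with prediction `Rh`. -/
inductive SFStep {V : Type*} [DecidableEq V] (γ : ℝ≥0) (PC : PCAlgorithm V) (G : SimpleGraph V)
    (c : Sym2 V → ℝ≥0) (Rh : List (V × V)) : SFState V → V × V → SFState V → Prop
  | minor (σ : SFState V) (r : V × V) (on' : OnState V)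
      (hon : OnStep G (freeOn c σ.S₀) σ.on r on')
      (hB : σ.newB c on' < 2 * σ.Bh) :
      SFStep γ PC G c Rh σ r ⟨σ.newB c on', σ.Bh, σ.S ∪ on'.F, σ.S₀, on'⟩
  /-- When the online cost has doubled: take the least `u` such that `Partial(Rh, u)` costs at
  most `3 * γ` times the new value of `Bh`, buy that solution `P`, and restart the online
  algorithm with all edges of the solution made free. -/
  | major (σ : SFState V) (r : V × V) (on' : OnState V) (u : ℕ) (P : Finset (Sym2 V))
      (hon : OnStep G (freeOn c σ.S₀) σ.on r on')
      (hB : 2 * σ.Bh ≤ σ.newB c on')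
      (hP : PartialWithin γ PC G c Rh (σ.newB c on') u P)
      (hu : ∀ u' < u, ¬ ∃ P', PartialWithin γ PC G c Rh (σ.newB c on') u' P') :
      SFStep γ PC G c Rh σ r
        ⟨σ.newB c on', σ.newB c on', σ.S ∪ on'.F ∪ P, σ.S ∪ on'.F ∪ P, OnState.init⟩

/-! ### Priority Steiner forest -/

/-- A request of priority Steiner forest: a terminal pair with its priority. -/
structure Request (V : Type*) (b : ℕ) where
  s : V
  t : V
  prio : Fin b

/-- The subgraph `G_j` of the edges of priority at least `j`. -/
def levelGraph {V : Type*} {b : ℕ} (G : SimpleGraph V) (pr : Sym2 V → Fin b) (j : Fin b) :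
    SimpleGraph V :=
  SimpleGraph.fromEdgeSet {e | e ∈ G.edgeSet ∧ j ≤ pr e}

/-- The terminal pairs of the requests of priority `j`. -/
def prioClass {V : Type*} {b : ℕ} (R : List (Request V b)) (j : Fin b) : List (V × V) :=
  (R.filter fun r => r.prio = j).map fun r => (r.s, r.t)

/-- `T` is a feasible solution: a set of edges of `G` in which the terminals of every request are
connected by edges of at least its priority. -/
def IsFeasible {V : Type*} {b : ℕ} (G : SimpleGraph V) (pr : Sym2 V → Fin b)
    (R : List (Request V b)) (T : Finset (Sym2 V)) : Prop :=
  (T : Set (Sym2 V)) ⊆ G.edgeSet ∧ ∀ r ∈ R, Connects {e | e ∈ T ∧ r.prio ≤ pr e} r.s r.t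

/-- `opt` is the cost of an optimal (offline) solution. -/
def IsOptCost {V : Type*} {b : ℕ} (G : SimpleGraph V) (c : Sym2 V → ℝ≥0) (pr : Sym2 V → Fin b)
    (R : List (Request V b)) (opt : ℝ≥0) : Prop :=
  IsLeast {x | ∃ T : Finset (Sym2 V), IsFeasible G pr R T ∧ cost c T = x} opt

/-- One step of the algorithm for priority Steiner forest with prediction `Rh`: a request of
priority `j` is sent to the `j`-th of `b` parallel instances, which runs on `G_j` and is given the
predicted requests of priority `j`. -/
def PSFStep {V : Type*} [DecidableEq V] {b : ℕ} (γ : ℝ≥0) (PC : PCAlgorithm V)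
    (G : SimpleGraph V) (c : Sym2 V → ℝ≥0) (pr : Sym2 V → Fin b) (Rh : List (Request V b))
    (σ : Fin b → SFState V) (r : Request V b) (σ' : Fin b → SFState V) : Prop :=
  SFStep γ PC (levelGraph G pr r.prio) c (prioClass Rh r.prio) (σ r.prio) (r.s, r.t) (σ' r.prio) ∧
    ∀ j, j ≠ r.prio → σ' j = σ j

/-- `PSFRun γ PC G c pr Rh σ R σ'`: starting in the state `σ`, serving the sequence `R` can lead
to the state `σ'`. -/
inductive PSFRun {V : Type*} [DecidableEq V] {b : ℕ} (γ : ℝ≥0) (PC : PCAlgorithm V)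
    (G : SimpleGraph V) (c : Sym2 V → ℝ≥0) (pr : Sym2 V → Fin b) (Rh : List (Request V b)) :
    (Fin b → SFState V) → List (Request V b) → (Fin b → SFState V) → Prop
  | nil (σ : Fin b → SFState V) : PSFRun γ PC G c pr Rh σ [] σ
  | cons (σ σ' σ'' : Fin b → SFState V) (r : Request V b) (R : List (Request V b))
      (h : PSFStep γ PC G c pr Rh σ r σ') (hR : PSFRun γ PC G c pr Rh σ' R σ'') :
      PSFRun γ PC G c pr Rh σ (r :: R) σ''

/-- `S` is a possible final solution of the algorithm on the request sequence `R`: the union of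
the solutions of the `b` instances. -/
def IsOutput {V : Type*} [DecidableEq V] {b : ℕ} (γ : ℝ≥0) (PC : PCAlgorithm V)
    (G : SimpleGraph V) (c : Sym2 V → ℝ≥0) (pr : Sym2 V → Fin b) (Rh R : List (Request V b))
    (S : Finset (Sym2 V)) : Prop :=
  ∃ σ : Fin b → SFState V,
    PSFRun γ PC G c pr Rh (fun _ => SFState.init) R σ ∧ S = Finset.univ.biUnion fun j => (σ j).S

/-! ### Metric error with outliers -/

/-- Matching cost of two requests: infinite if their priorities differ, and otherwise the distance
of the terminal pairs in the graph of the edges of at least that priority. -/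
def matchCost {V : Type*} {b : ℕ} (G : SimpleGraph V) (c : Sym2 V → ℝ≥0) (pr : Sym2 V → Fin b)
    (r q : Request V b) : ℝ≥0∞ :=
  if r.prio = q.prio then
    min (gdist (levelGraph G pr r.prio) c r.s q.s + gdist (levelGraph G pr r.prio) c r.t q.t)
      (gdist (levelGraph G pr r.prio) c r.s q.t + gdist (levelGraph G pr r.prio) c q.s r.t)
  else ⊤

/-- `(Δ, D)` is a metric error with outliers of the prediction `Rh` for the input `R`: for some
equally large parts `M` of `R` and `Mh` of `Rh` (given by positions), the minimum cost of a perfect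
matching between `M` and `Mh` is `D`, and `Δ` is the number of requests and predicted requests
outside these parts. -/
def IsMetricError {V : Type*} {b : ℕ} (G : SimpleGraph V) (c : Sym2 V → ℝ≥0)
    (pr : Sym2 V → Fin b) (R Rh : List (Request V b)) (Δ : ℕ) (D : ℝ≥0) : Prop :=
  ∃ (M : Finset (Fin R.length)) (Mh : Finset (Fin Rh.length)),
    M.card = Mh.card ∧
    IsLeast (Set.range fun e : M ≃ Mh =>
      ∑ i : M, matchCost G c pr (R.get i.1) (Rh.get (e i).1)) (D : ℝ≥0∞) ∧
    Mᶜ.card + Mhᶜ.card = Δ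

end PSF

end

/-! Fix an offline solution `T`. For the online algorithm, the open balls in one collection `D_ℓ`
are disjoint and each centre is joined by `T` to a point outside its ball, so `T` pays the radius in
every ball (`card_mul_le_cost`). Every request of level `ℓ` and positive cost either adds a ball or
merges two classes of centres in the bought forest. Hence a level holds at most twice as many such
requests as balls (`OnInv.count`) and costs `O(c(T))`. For a set of `m` requests only about `log m`
levels matter, because lower ones are negligible in total (`sum_le_of_levels`). The argument applies
to every subset of the served requests (`OnInv.sum_le`), and each single request costs at most twice
its terminal distance.

This subset property is what makes predictions useful. `T` together with the matching paths is a
solution `T'` of cost at most `c(T) + D` that serves every matched predicted pair. Once the budget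
`Bh` exceeds that cost, the prize-collecting subroutine leaves at most `2γ` times the number of
predicted outliers unserved (`exists_partialWithin`, `IsPartial.unsat_le`). From then on, a request
matched to a served pair can detour over that pair for free, so it costs at most twice its matching
cost. All other requests number `O(Δ)` and are charged to `T` with a factor `log Δ`
(`IsPhaseCost.le_log_add`, `IsPhaseCost.le_of_matching`).

Doubling turns bounds for one phase into bounds for the counter `B`: a restart happens only when the
finished phase costs at least the old `Bh`, so the accumulated cost is at most a constant times a
phase bound (`IsSFRun.B_le_of_phase`, `IsSFRun.B_le_of_prediction`). The purchased solution costs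
`O(γ B)` by `SFInv.cost_le`. Finally, each priority is compared with the optimum restricted to its
graph, which costs at most `OPT`; concavity of the logarithm adds up the `b` bounds (`sum_log_le`).
-/

namespace PSF

section Walks

variable {V : Type*} {G : SimpleGraph V} {c c' : Sym2 V → ℝ≥0} {u v w : V}

/-! ### Walk costs and distances -/

lemma walkCost_nil : walkCost c (SimpleGraph.Walk.nil : G.Walk u u) = 0 := by
  simp [walkCost]

lemma walkCost_append (p : G.Walk u v) (q : G.Walk v w) :
    walkCost c (p.append q) = walkCost c p + walkCost c q := by
  simp [walkCost, SimpleGraph.Walk.edges_append]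

lemma walkCost_reverse (p : G.Walk u v) : walkCost c p.reverse = walkCost c p := by
  simp [walkCost, SimpleGraph.Walk.edges_reverse, List.sum_reverse]

lemma walkCost_toWalk (h : G.Adj u v) : walkCost c h.toWalk = c s(u, v) := by
  simp [walkCost, SimpleGraph.Adj.toWalk]

lemma walkCost_mono (h : ∀ e, c e ≤ c' e) (p : G.Walk u v) : walkCost c p ≤ walkCost c' p :=
  List.sum_le_sum fun e _ => h e

lemma walkCost_eq_zero (p : G.Walk u v) (h : ∀ e ∈ p.edges, c e = 0) : walkCost c p = 0 := by
  refine List.sum_eq_zero ?_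
  simpa using h

lemma walkCost_bypass_le [DecidableEq V] (p : G.Walk u v) :
    walkCost c p.bypass ≤ walkCost c p :=
  (p.edges_bypass_sublist_edges.map c).sum_le_sum fun _ _ => zero_le

lemma walkCost_eq_cost [DecidableEq V] {p : G.Walk u v} (hp : p.IsPath) :
    walkCost c p = cost c p.edges.toFinset := by
  rw [cost, List.sum_toFinset _ hp.isTrail.edges_nodup, walkCost]

lemma cost_union_le [DecidableEq V] (S S' : Finset (Sym2 V)) :
    cost c (S ∪ S') ≤ cost c S + cost c S' := by
  rw [cost, cost, cost, ← Finset.sum_union_inter]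
  exact le_self_add

lemma cost_toFinset_le [DecidableEq V] (p : G.Walk u v) :
    cost c p.edges.toFinset ≤ walkCost c p := by
  induction p with
  | nil => simp [cost]
  | cons h p ih =>
    simp only [SimpleGraph.Walk.edges_cons, List.toFinset_cons, walkCost, List.map_cons,
      List.sum_cons]
    rw [Finset.insert_eq]
    exact (cost_union_le _ _).trans (add_le_add (by simp [cost]) ih)

lemma gdist_le (p : G.Walk u v) : gdist G c u v ≤ walkCost c p := iInf_le _ p

lemma gdist_self (u : V) : gdist G c u u = 0 := by
  have := gdist_le (c := c) (SimpleGraph.Walk.nil : G.Walk u u)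
  simpa [walkCost_nil] using this

lemma gdist_lt_iff {x : ℝ≥0∞} :
    gdist G c u v < x ↔ ∃ p : G.Walk u v, (walkCost c p : ℝ≥0∞) < x := iInf_lt_iff

lemma le_gdist_iff {x : ℝ≥0∞} :
    x ≤ gdist G c u v ↔ ∀ p : G.Walk u v, x ≤ (walkCost c p : ℝ≥0∞) := le_iInf_iff

lemma gdist_comm (u v : V) : gdist G c u v = gdist G c v u := by
  apply le_antisymm <;> refine le_gdist_iff.2 fun p => ?_ <;>
    exact (gdist_le p.reverse).trans (by rw [walkCost_reverse])

lemma gdist_triangle (u v w : V) : gdist G c u w ≤ gdist G c u v + gdist G c v w := by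
  refine ENNReal.le_of_forall_pos_le_add fun ε hε hfin => ?_
  have h1 : gdist G c u v ≠ ⊤ := fun h => by simp [h] at hfin
  have h2 : gdist G c v w ≠ ⊤ := fun h => by simp [h] at hfin
  have hε2 : ((ε / 2 : ℝ≥0) : ℝ≥0∞) ≠ 0 := by simpa using hε.ne'
  obtain ⟨p, hp⟩ := gdist_lt_iff.1 (ENNReal.lt_add_right h1 hε2)
  obtain ⟨q, hq⟩ := gdist_lt_iff.1 (ENNReal.lt_add_right h2 hε2)
  calc gdist G c u w ≤ walkCost c (p.append q) := gdist_le _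
    _ = walkCost c p + walkCost c q := by rw [walkCost_append]; push_cast; rfl
    _ ≤ (gdist G c u v + (ε / 2 : ℝ≥0)) + (gdist G c v w + (ε / 2 : ℝ≥0)) :=
        add_le_add hp.le hq.le
    _ = gdist G c u v + gdist G c v w + ((ε / 2 + ε / 2 : ℝ≥0) : ℝ≥0∞) := by
        push_cast; ring
    _ = gdist G c u v + gdist G c v w + ε := by rw [add_halves]

lemma gdist_mono (h : ∀ e, c e ≤ c' e) (u v : V) : gdist G c u v ≤ gdist G c' u v :=
  le_gdist_iff.2 fun p => (gdist_le p).trans (by exact_mod_cast walkCost_mono h p)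

lemma gdist_adj (h : G.Adj u v) : gdist G c u v ≤ c s(u, v) := by
  simpa [walkCost_toWalk] using gdist_le (c := c) h.toWalk

lemma reachable_of_gdist_ne_top (h : gdist G c u v ≠ ⊤) : G.Reachable u v := by
  obtain ⟨p, -⟩ := gdist_lt_iff.1 (lt_top_iff_ne_top.2 h)
  exact ⟨p⟩

lemma IsShortest.le_gdist {p : G.Walk u v} (hp : IsShortest c p) :
    (walkCost c p : ℝ≥0∞) ≤ gdist G c u v :=
  le_gdist_iff.2 fun q => by exact_mod_cast hp.2 q

/-- There are infinitely many walks, but bypassing reduces each to a path at no extra cost, and the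
cost of a path is the cost of an edge set, which takes finitely many values. -/
lemma exists_isShortest [Fintype V] [DecidableEq V] (c : Sym2 V → ℝ≥0) (h : G.Reachable u v) :
    ∃ p : G.Walk u v, IsShortest c p := by
  have hfin : (Set.range fun p : G.Path u v => walkCost c p.1).Finite := by
    refine (Set.finite_range fun S : Finset (Sym2 V) => cost c S).subset ?_
    rintro _ ⟨p, rfl⟩
    exact ⟨p.1.edges.toFinset, (walkCost_eq_cost p.2).symm⟩
  obtain ⟨q⟩ := h
  obtain ⟨_, ⟨p, rfl⟩, hp⟩ := Set.exists_min_image _ id hfin ⟨_, ⟨⟨q.bypass, q.bypass_isPath⟩, rfl⟩⟩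
  refine ⟨p.1, p.2, fun q => ?_⟩
  exact (hp _ ⟨⟨q.bypass, q.bypass_isPath⟩, rfl⟩).trans (walkCost_bypass_le q)

lemma exists_isPath_of_connects [DecidableEq V] {S : Set (Sym2 V)} (hS : S ⊆ G.edgeSet)
    (h : Connects S u v) : ∃ p : G.Walk u v, p.IsPath ∧ ∀ e ∈ p.edges, e ∈ S := by
  obtain ⟨p⟩ := h
  have hp : ∀ e ∈ p.edges, e ∈ S := fun e he => by
    have := p.edges_subset_edgeSet he
    rw [SimpleGraph.edgeSet_fromEdgeSet] at this
    exact this.1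
  let q := p.transfer G fun e he => hS (hp e he)
  refine ⟨q.bypass, q.bypass_isPath, fun e he => hp e ?_⟩
  have := q.edges_bypass_subset_edges he
  rwa [SimpleGraph.Walk.edges_transfer] at this

lemma connects_of_walk {S : Set (Sym2 V)} (p : G.Walk u v) (h : ∀ e ∈ p.edges, e ∈ S) :
    Connects S u v := by
  refine ⟨p.transfer _ fun e he => ?_⟩
  rw [SimpleGraph.edgeSet_fromEdgeSet]
  exact ⟨h e he, fun hd => G.not_isDiag_of_mem_edgeSet (p.edges_subset_edgeSet he) hd⟩

lemma Connects.mono {S S' : Set (Sym2 V)} (hS : S ⊆ S') (h : Connects S u v) : Connects S' u v :=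
  SimpleGraph.Reachable.mono (SimpleGraph.fromEdgeSet_mono hS) h

/-! ### Costs of edge sets and free edges -/

lemma cost_mono {S S' : Finset (Sym2 V)} (h : S ⊆ S') : cost c S ≤ cost c S' :=
  Finset.sum_le_sum_of_subset h

lemma cost_mono_left (h : ∀ e, c e ≤ c' e) (S : Finset (Sym2 V)) : cost c S ≤ cost c' S :=
  Finset.sum_le_sum fun e _ => h e

variable [DecidableEq V]

lemma freeOn_le (c : Sym2 V → ℝ≥0) (S : Finset (Sym2 V)) (e : Sym2 V) : freeOn c S e ≤ c e := by
  unfold freeOn; split_ifs <;> simp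

lemma freeOn_of_mem {S : Finset (Sym2 V)} {e : Sym2 V} (h : e ∈ S) : freeOn c S e = 0 := if_pos h

lemma cost_sdiff_le (S F : Finset (Sym2 V)) : cost c (S \ F) ≤ cost (freeOn c F) S := by
  calc cost c (S \ F) = ∑ e ∈ S \ F, freeOn c F e :=
        Finset.sum_congr rfl fun e he => by simp [freeOn, (Finset.mem_sdiff.1 he).2]
    _ ≤ cost (freeOn c F) S := Finset.sum_le_sum_of_subset Finset.sdiff_subset

lemma cost_walk_sdiff_le (p : G.Walk u v) (F : Finset (Sym2 V)) :
    cost c (p.edges.toFinset \ F) ≤ walkCost (freeOn c F) p :=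
  (cost_sdiff_le _ _).trans (cost_toFinset_le p)

lemma gdist_eq_zero_of_connects {S : Finset (Sym2 V)} (hS : (S : Set (Sym2 V)) ⊆ G.edgeSet)
    (h : Connects (S : Set (Sym2 V)) u v) : gdist G (freeOn c S) u v = 0 := by
  obtain ⟨p, -, hp⟩ := exists_isPath_of_connects hS h
  have := gdist_le (c := freeOn c S) p
  rw [walkCost_eq_zero p fun e he => freeOn_of_mem (hp e he)] at this
  simpa using this

lemma gdist_le_cost_of_connects {S : Finset (Sym2 V)} (hS : (S : Set (Sym2 V)) ⊆ G.edgeSet)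
    (h : Connects (S : Set (Sym2 V)) u v) : gdist G c u v ≤ cost c S := by
  obtain ⟨p, hp, hpS⟩ := exists_isPath_of_connects hS h
  refine (gdist_le p).trans ?_
  rw [walkCost_eq_cost hp]
  exact_mod_cast cost_mono fun e he => by simpa using hpS e (by simpa using he)

end Walks

/-! ### Disjoint balls bound the cost of a solution from below -/

section Moats

variable {V : Type*} {G : SimpleGraph V} {c : Sym2 V → ℝ≥0}

/-- The distance from `a`, truncated at `r`. -/
noncomputable def truncDist (G : SimpleGraph V) (c : Sym2 V → ℝ≥0) (r : ℝ≥0) (a x : V) : ℝ :=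
  (min (gdist G c a x) r).toReal

lemma truncDist_nonneg (r : ℝ≥0) (a x : V) : 0 ≤ truncDist G c r a x := ENNReal.toReal_nonneg

lemma truncDist_le (r : ℝ≥0) (a x : V) : truncDist G c r a x ≤ r :=
  ENNReal.toReal_le_coe_of_le_coe (min_le_right _ _)

lemma truncDist_self (r : ℝ≥0) (a : V) : truncDist G c r a a = 0 := by
  simp [truncDist, gdist_self]

lemma truncDist_of_le {r : ℝ≥0} {a x : V} (h : (r : ℝ≥0∞) ≤ gdist G c a x) :
    truncDist G c r a x = r := by
  simp [truncDist, min_eq_right h]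

lemma ofReal_truncDist {r : ℝ≥0} {a x : V} (h : truncDist G c r a x < r) :
    gdist G c a x = ENNReal.ofReal (truncDist G c r a x) := by
  rcases le_total (r : ℝ≥0∞) (gdist G c a x) with h' | h'
  · exact absurd (truncDist_of_le h') h.ne
  · rw [truncDist, min_eq_left h', ENNReal.ofReal_toReal (ne_top_of_le_ne_top (by simp) h')]

lemma truncDist_adj (r : ℝ≥0) (a : V) {x y : V} (h : G.Adj x y) :
    truncDist G c r a y ≤ truncDist G c r a x + c s(x, y) := by
  by_cases hx : truncDist G c r a x < r
  · have h1 : gdist G c a y ≤ ENNReal.ofReal (truncDist G c r a x + c s(x, y)) := by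
      rw [ENNReal.ofReal_add (truncDist_nonneg ..) (by positivity), ← ofReal_truncDist hx,
        ENNReal.ofReal_coe_nnreal]
      exact (gdist_triangle a x y).trans (add_le_add_right (gdist_adj h) _)
    exact ENNReal.toReal_le_of_le_ofReal (by
        have := truncDist_nonneg (G := G) (c := c) r a x
        positivity)
      ((min_le_left _ _).trans h1)
  · have := truncDist_le (G := G) (c := c) r a y
    have : (0 : ℝ) ≤ c s(x, y) := by positivity
    linarith

/-- The route from `a` over `x` and `y` to `b` has length at least `r + r`. With `z` an edge cost
this bounds what two balls take from one edge; with `x = y` and `z = 0` it shows that no vertex lies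
in two of the open balls. -/
lemma le_truncDist_add {r : ℝ≥0} {a b x y : V}
    (hab : ((r + r : ℝ≥0) : ℝ≥0∞) ≤ gdist G c a b) {z : ℝ≥0} (hxy : gdist G c x y ≤ z)
    (hx : truncDist G c r a x < r) (hy : truncDist G c r b y < r) :
    (r : ℝ) + r ≤ truncDist G c r a x + z + truncDist G c r b y := by
  have h1 : gdist G c a b ≤ ENNReal.ofReal (truncDist G c r a x + z + truncDist G c r b y) := by
    rw [ENNReal.ofReal_add (by
        have := truncDist_nonneg (G := G) (c := c) r a x
        positivity)
      (truncDist_nonneg ..), ENNReal.ofReal_add (truncDist_nonneg ..) (by positivity),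
      ← ofReal_truncDist hx, ← ofReal_truncDist hy, ENNReal.ofReal_coe_nnreal]
    calc gdist G c a b ≤ gdist G c a y + gdist G c y b := gdist_triangle _ _ _
      _ ≤ (gdist G c a x + gdist G c x y) + gdist G c y b :=
          add_le_add_left (gdist_triangle _ _ _) _
      _ ≤ gdist G c a x + z + gdist G c b y := by
          rw [gdist_comm y b]; gcongr
  have h2 := hab.trans h1
  rw [← ENNReal.ofReal_coe_nnreal, ENNReal.ofReal_le_ofReal_iff
    (by have := truncDist_nonneg (G := G) (c := c) r a x
        have := truncDist_nonneg (G := G) (c := c) r b y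
        positivity)] at h2
  simpa using h2

/-- The part of an edge which lies in the ball of radius `r` around `a`. -/
noncomputable def ballPart (G : SimpleGraph V) (c : Sym2 V → ℝ≥0) (r : ℝ≥0) (a : V) :
    Sym2 V → ℝ :=
  Sym2.lift ⟨fun x y => |truncDist G c r a x - truncDist G c r a y|, fun _ _ => abs_sub_comm _ _⟩

lemma ballPart_nonneg (r : ℝ≥0) (a : V) (e : Sym2 V) : 0 ≤ ballPart G c r a e := by
  induction e with
  | _ x y => exact abs_nonneg _

lemma sum_ballPart_le {r : ℝ≥0} {D : Finset V}
    (sep : ∀ a ∈ D, ∀ b ∈ D, a ≠ b → ((r + r : ℝ≥0) : ℝ≥0∞) ≤ gdist G c a b) {e : Sym2 V}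
    (he : e ∈ G.edgeSet) : ∑ a ∈ D, ballPart G c r a e ≤ c e := by
  classical
  induction e with
  | _ x y =>
  have hxy : G.Adj x y := he
  have bp : ∀ a, ballPart G c r a s(x, y) = |truncDist G c r a x - truncDist G c r a y| :=
    fun _ => rfl
  have hone : ∀ a, ballPart G c r a s(x, y) ≤ c s(x, y) := fun a => by
    rw [bp, abs_sub_le_iff]
    have h1 := truncDist_adj (c := c) r a hxy
    have h2 := truncDist_adj (c := c) r a hxy.symm
    rw [Sym2.eq_swap] at h2
    constructor <;> linarith
  have hsame : ∀ z, ∀ a ∈ D, ∀ b ∈ D, truncDist G c r a z < r → a ≠ b →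
      truncDist G c r b z = r := fun z a ha b hb hz hab => by
    refine le_antisymm (truncDist_le ..) (not_lt.1 fun h => ?_)
    have := le_truncDist_add (sep a ha b hb hab) (z := 0) (by simp [gdist_self]) hz h
    simp only [NNReal.coe_zero] at this
    linarith
  have hfar : ∀ a, ¬ truncDist G c r a x < r → ¬ truncDist G c r a y < r →
      ballPart G c r a s(x, y) = 0 := fun a h1 h2 => by
    rw [bp, le_antisymm (truncDist_le r a x) (not_lt.1 h1),
      le_antisymm (truncDist_le r a y) (not_lt.1 h2)]
    simp
  -- Each end point lies in at most one ball, so at most two summands are nonzero. Two distinct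
  -- balls at the two ends share the edge without overlap; a single ball takes at most the whole
  -- edge.
  by_cases hX : ∃ a ∈ D, truncDist G c r a x < r
  · obtain ⟨a, ha, hax⟩ := hX
    by_cases hY : ∃ b ∈ D, b ≠ a ∧ truncDist G c r b y < r
    · obtain ⟨b, hb, hba, hby⟩ := hY
      rw [Finset.sum_eq_add_of_mem a b ha hb hba.symm fun z hz hne => hfar z
        (hsame x a ha z hz hax hne.1.symm).not_lt (hsame y b hb z hz hby hne.2.symm).not_lt, bp, bp,
        hsame x a ha b hb hax hba.symm, hsame y b hb a ha hby hba]
      have := le_truncDist_add (sep a ha b hb hba.symm) (gdist_adj hxy) hax hby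
      rw [abs_of_nonpos (by linarith), abs_of_nonneg (by linarith)]
      linarith
    · push Not at hY
      rw [Finset.sum_eq_single_of_mem a ha fun z hz hne => hfar z
        (hsame x a ha z hz hax hne.symm).not_lt (hY z hz hne).not_gt]
      exact hone a
  · push Not at hX
    by_cases hY : ∃ b ∈ D, truncDist G c r b y < r
    · obtain ⟨b, hb, hby⟩ := hY
      rw [Finset.sum_eq_single_of_mem b hb fun z hz hne => hfar z (hX z hz).not_gt
        (hsame y b hb z hz hby hne.symm).not_lt]
      exact hone b
    · push Not at hY
      rw [Finset.sum_eq_zero fun z hz => hfar z (hX z hz).not_gt (hY z hz).not_gt]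
      positivity

lemma abs_truncDist_sub_le (r : ℝ≥0) (a : V) {x y : V} (p : G.Walk x y) :
    |truncDist G c r a x - truncDist G c r a y| ≤ (p.edges.map (ballPart G c r a)).sum := by
  induction p with
  | nil => simp
  | @cons x y z h p ih =>
    simp only [SimpleGraph.Walk.edges_cons, List.map_cons, List.sum_cons]
    exact (abs_sub_le _ _ _).trans (add_le_add_right ih _)

/-- If balls of radius `r` are disjoint and `T` connects each center to a point outside its ball,
then `T` pays at least `r` in each ball. -/
lemma card_mul_le_cost {r : ℝ≥0} {D : Finset V} {T : Finset (Sym2 V)}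
    (hT : (T : Set (Sym2 V)) ⊆ G.edgeSet)
    (sep : ∀ a ∈ D, ∀ b ∈ D, a ≠ b → ((r + r : ℝ≥0) : ℝ≥0∞) ≤ gdist G c a b)
    (out : ∀ a ∈ D, ∃ t, Connects (T : Set (Sym2 V)) a t ∧ (r : ℝ≥0∞) ≤ gdist G c a t) :
    D.card * r ≤ cost c T := by
  classical
  have key : ∀ a ∈ D, (r : ℝ) ≤ ∑ e ∈ T, ballPart G c r a e := fun a ha => by
    obtain ⟨t, hat, hd⟩ := out a ha
    obtain ⟨p, hp, hpT⟩ := exists_isPath_of_connects hT hat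
    -- Along the path the truncated distance from `a` rises from `0` to `r`, and each edge
    -- contributes at most its part in the ball.
    have h1 := abs_truncDist_sub_le (c := c) r a p
    rw [truncDist_self, truncDist_of_le hd, zero_sub, abs_neg, NNReal.abs_eq,
      ← List.sum_toFinset _ hp.isTrail.edges_nodup] at h1
    exact h1.trans (Finset.sum_le_sum_of_subset_of_nonneg
      (fun e he => by simpa using hpT e (by simpa using he)) fun e _ _ => ballPart_nonneg ..)
  have h2 : (D.card : ℝ) * r ≤ ∑ e ∈ T, (c e : ℝ) := by
    rw [← nsmul_eq_mul, ← Finset.sum_const]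
    refine (Finset.sum_le_sum key).trans ?_
    rw [Finset.sum_comm]
    exact Finset.sum_le_sum fun e he => sum_ballPart_le sep (hT he)
  rw [← NNReal.coe_le_coe]
  simpa [cost] using h2

end Moats

/-! ### Components -/

section Components

variable {V : Type*}

open Classical in
/-- The number of classes of the vertices in `D` with respect to connection by `F`. -/
noncomputable def comps (F : Finset (Sym2 V)) (D : Finset V) : ℕ :=
  (D.image (SimpleGraph.fromEdgeSet (F : Set (Sym2 V))).connectedComponentMk).card

variable {F F' : Finset (Sym2 V)} {D : Finset V}

/-- Enlarging the edge set can only merge classes: the new classes are an image of the old ones. -/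
lemma image_connectedComponentMk
    [DecidableEq (SimpleGraph.fromEdgeSet (F : Set (Sym2 V))).ConnectedComponent]
    [DecidableEq (SimpleGraph.fromEdgeSet (F' : Set (Sym2 V))).ConnectedComponent] (h : F ⊆ F') :
    D.image (SimpleGraph.fromEdgeSet (F' : Set (Sym2 V))).connectedComponentMk =
      (D.image (SimpleGraph.fromEdgeSet (F : Set (Sym2 V))).connectedComponentMk).image
        (SimpleGraph.ConnectedComponent.map (SimpleGraph.Hom.ofLE
          (SimpleGraph.fromEdgeSet_mono (Finset.coe_subset.2 h)))) := by
  rw [Finset.image_image]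
  rfl

lemma comps_empty : comps F ∅ = 0 := by
  classical
  exact Nat.le_zero.1 Finset.card_image_le

lemma comps_mono (h : F ⊆ F') : comps F' D ≤ comps F D := by
  classical
  unfold comps
  rw [image_connectedComponentMk h]
  exact Finset.card_image_le

/-- If the number of classes stayed the same, the merging map would be injective on the classes
meeting `D`, so `a₁` and `a₂` would already have been connected. -/
lemma comps_lt (h : F ⊆ F') {a₁ a₂ : V} (h₁ : a₁ ∈ D) (h₂ : a₂ ∈ D)
    (hc : Connects (F' : Set (Sym2 V)) a₁ a₂) (hn : ¬ Connects (F : Set (Sym2 V)) a₁ a₂) :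
    comps F' D < comps F D := by
  classical
  refine lt_of_le_of_ne (comps_mono h) fun heq => hn ?_
  unfold comps at heq
  rw [image_connectedComponentMk h] at heq
  have hinj := Finset.card_image_iff.1 heq
  refine SimpleGraph.ConnectedComponent.exact (hinj
    (by exact_mod_cast Finset.mem_image_of_mem _ h₁)
    (by exact_mod_cast Finset.mem_image_of_mem _ h₂) ?_)
  exact SimpleGraph.ConnectedComponent.sound hc

lemma comps_insert [DecidableEq V] (v : V) : comps F (insert v D) ≤ comps F D + 1 := by
  classical
  unfold comps
  rw [Finset.image_insert]
  exact Finset.card_insert_le _ _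

end Components

/-! ### Dyadic levels and the analysis of the online algorithm -/

lemma zpow_level_le {x : ℝ≥0} (hx : 0 < x) : (2 : ℝ≥0) ^ level x ≤ x := by
  rw [← NNReal.coe_le_coe, NNReal.coe_zpow, ← Real.rpow_intCast, NNReal.coe_ofNat,
    ← Real.le_logb_iff_rpow_le one_lt_two (by exact_mod_cast hx)]
  exact Int.floor_le _

lemma lt_zpow_level {x : ℝ≥0} (hx : 0 < x) : x < (2 : ℝ≥0) ^ (level x + 1) := by
  rw [← NNReal.coe_lt_coe, NNReal.coe_zpow, ← Real.rpow_intCast, NNReal.coe_ofNat,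
    ← Real.logb_lt_iff_lt_rpow one_lt_two (by exact_mod_cast hx)]
  push_cast
  exact Int.lt_floor_add_one _

/-- Two intersections of balls of radius `2 ^ (ℓ - 2)` span less than four radii, which is exactly
the lower bound `2 ^ ℓ` on a path of level `ℓ`. This is why the radius is a quarter of `2 ^ ℓ`. -/
lemma zpow_sub_two_add (ℓ : ℤ) :
    ((2 : ℝ≥0) ^ (ℓ - 2) + 2 ^ (ℓ - 2)) + (2 ^ (ℓ - 2) + 2 ^ (ℓ - 2)) = 2 ^ ℓ := by
  rw [zpow_sub₀ two_ne_zero]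
  have : (2 : ℝ≥0) ^ (2 : ℤ) = 4 := by norm_num [zpow_ofNat]
  rw [this, ← NNReal.coe_inj]
  push_cast
  ring

section Online

variable {V : Type*} {G : SimpleGraph V} {c : Sym2 V → ℝ≥0}

lemma OnStep.subset [DecidableEq V] {σ σ' : OnState V} {r : V × V} (h : OnStep G c σ r σ') :
    σ.F ⊆ σ'.F := by
  cases h with
  | free => exact Finset.subset_union_left
  | newBall => exact Finset.subset_union_left
  | connect s t p ℓ F₁ a₁ a₂ p₁ p₂ hp hpos hℓ hF₁ =>
    subst hF₁
    exact Finset.subset_union_left.trans (Finset.subset_union_left.trans Finset.subset_union_left)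

lemma OnStep.subset_edgeSet [DecidableEq V] {σ σ' : OnState V} {r : V × V} (h : OnStep G c σ r σ')
    (hF : (σ.F : Set (Sym2 V)) ⊆ G.edgeSet) : (σ'.F : Set (Sym2 V)) ⊆ G.edgeSet := by
  have hw : ∀ {u v : V} (p : G.Walk u v), (p.edges.toFinset : Set (Sym2 V)) ⊆ G.edgeSet :=
    fun p e he => p.edges_subset_edgeSet (by simpa using he)
  cases h with
  | free => simpa only [Finset.coe_union, Set.union_subset_iff] using ⟨hF, hw _⟩
  | newBall => simpa only [Finset.coe_union, Set.union_subset_iff] using ⟨hF, hw _⟩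
  | connect s t p ℓ F₁ a₁ a₂ p₁ p₂ hp hpos hℓ hF₁ =>
    subst hF₁
    simpa only [Finset.coe_union, Set.union_subset_iff] using ⟨⟨⟨hF, hw _⟩, hw _⟩, hw _⟩

lemma OnStep.connects [DecidableEq V] {σ σ' : OnState V} {r : V × V} (h : OnStep G c σ r σ') :
    Connects (σ'.F : Set (Sym2 V)) r.1 r.2 := by
  cases h with
  | free s t p => exact connects_of_walk p fun e he => by simp [he]
  | newBall s t p => exact connects_of_walk p fun e he => by simp [he]
  | connect s t p ℓ F₁ a₁ a₂ p₁ p₂ hp hpos hℓ hF₁ =>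
    subst hF₁
    exact connects_of_walk p fun e he => by simp [he]

lemma exists_onStep [Fintype V] [DecidableEq V] (G : SimpleGraph V) (c : Sym2 V → ℝ≥0)
    (σ : OnState V) {s t : V}
    (h : G.Reachable s t) : ∃ σ', OnStep G c σ (s, t) σ' := by
  obtain ⟨p, hp⟩ := exists_isShortest (freeOn c σ.F) h
  rcases eq_zero_or_pos (walkCost (freeOn c σ.F) p) with h0 | hpos
  · exact ⟨_, .free σ s t p hp h0⟩
  by_cases hs : ∀ a ∈ σ.duals (level (walkCost (freeOn c σ.F) p)), ¬ BallsIntersect G c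
      (level (walkCost (freeOn c σ.F) p)) s a
  · exact ⟨_, .newBall σ s t p _ s hp hpos rfl (.inl rfl) hs⟩
  by_cases ht : ∀ a ∈ σ.duals (level (walkCost (freeOn c σ.F) p)), ¬ BallsIntersect G c
      (level (walkCost (freeOn c σ.F) p)) t a
  · exact ⟨_, .newBall σ s t p _ t hp hpos rfl (.inr rfl) ht⟩
  push Not at hs ht
  obtain ⟨a₁, ha₁, hi₁⟩ := hs
  obtain ⟨a₂, ha₂, hi₂⟩ := ht
  have hr : ∀ {u v}, BallsIntersect G c (level (walkCost (freeOn c σ.F) p)) u v →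
      G.Reachable v u := fun hi =>
    (reachable_of_gdist_ne_top (ne_top_of_lt hi)).symm
  obtain ⟨p₁, hp₁⟩ := exists_isShortest (freeOn c (σ.F ∪ p.edges.toFinset)) (hr hi₁)
  obtain ⟨p₂, hp₂⟩ := exists_isShortest (freeOn c (σ.F ∪ p.edges.toFinset)) (hr hi₂)
  exact ⟨_, .connect σ s t p _ _ a₁ a₂ p₁ p₂ hp hpos rfl rfl ha₁ hi₁ ha₂ hi₂ hp₁ hp₂⟩

/-- The invariant of the online algorithm which has served the requests `r i`, `i ∈ X`, at costs
`κ i`, while `T` is an offline solution for them. The requests of positive cost are classified by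
their level `lev i`. -/
structure OnInv (G : SimpleGraph V) (c : Sym2 V → ℝ≥0) (T : Finset (Sym2 V)) (r : ℕ → V × V)
    (κ : ℕ → ℝ≥0) (σ : OnState V) (X : Finset ℕ) (lev : ℕ → ℤ) : Prop where
  sub : (σ.F : Set (Sym2 V)) ⊆ G.edgeSet
  sep : ∀ ℓ, ∀ a ∈ σ.duals ℓ, ∀ b ∈ σ.duals ℓ, a ≠ b → ¬ BallsIntersect G c ℓ a b
  out : ∀ ℓ, ∀ a ∈ σ.duals ℓ, ∃ t, Connects (T : Set (Sym2 V)) a t ∧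
    ((2 ^ ℓ : ℝ≥0) : ℝ≥0∞) ≤ gdist G c a t
  count : ∀ ℓ, (X.filter fun i => κ i ≠ 0 ∧ lev i = ℓ).card + comps σ.F (σ.duals ℓ)
    ≤ 2 * (σ.duals ℓ).card
  cost_le_level : ∀ i ∈ X, κ i ≠ 0 → κ i ≤ 4 * 2 ^ lev i ∧ 2 ^ lev i ≤ cost c T
  cost_le_gdist : ∀ i ∈ X, (κ i : ℝ≥0∞) ≤ 2 * gdist G c (r i).1 (r i).2

lemma onInv_init (T : Finset (Sym2 V)) (r : ℕ → V × V) (κ : ℕ → ℝ≥0) (lev : ℕ → ℤ) :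
    OnInv G c T r κ OnState.init ∅ lev := by
  constructor <;> simp [OnState.init, comps_empty]

variable {T : Finset (Sym2 V)} {r : ℕ → V × V} {κ : ℕ → ℝ≥0} {σ σ' : OnState V} {X : Finset ℕ}
  {lev : ℕ → ℤ}

/-- Extension of the invariant by one request; `ℓ` is its level. -/
lemma OnInv.extend (hI : OnInv G c T r κ σ X lev) {i : ℕ} (hi : i ∉ X) (ℓ : ℤ)
    (sub : (σ'.F : Set (Sym2 V)) ⊆ G.edgeSet) (hFF : σ.F ⊆ σ'.F)
    (hne : ∀ ℓ' ≠ ℓ, σ'.duals ℓ' = σ.duals ℓ')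
    (sep : ∀ a ∈ σ'.duals ℓ, ∀ b ∈ σ'.duals ℓ, a ≠ b → ¬ BallsIntersect G c ℓ a b)
    (out : ∀ a ∈ σ'.duals ℓ, ∃ t, Connects (T : Set (Sym2 V)) a t ∧
      ((2 ^ ℓ : ℝ≥0) : ℝ≥0∞) ≤ gdist G c a t)
    (count : (if κ i = 0 then 0 else 1) + comps σ'.F (σ'.duals ℓ) + 2 * (σ.duals ℓ).card
      ≤ 2 * (σ'.duals ℓ).card + comps σ.F (σ.duals ℓ))
    (hl : κ i ≠ 0 → κ i ≤ 4 * 2 ^ ℓ ∧ 2 ^ ℓ ≤ cost c T)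
    (hd : (κ i : ℝ≥0∞) ≤ 2 * gdist G c (r i).1 (r i).2) :
    OnInv G c T r κ σ' (insert i X) (Function.update lev i ℓ) := by
  have hlev : ∀ j ∈ X, Function.update lev i ℓ j = lev j := fun j hj =>
    Function.update_of_ne (fun h : j = i => hi (h ▸ hj)) _ _
  have hfilter : ∀ ℓ', (X.filter fun j => κ j ≠ 0 ∧ Function.update lev i ℓ j = ℓ') =
      X.filter fun j => κ j ≠ 0 ∧ lev j = ℓ' := fun ℓ' =>
    Finset.filter_congr fun j hj => by rw [hlev j hj]
  refine ⟨sub, fun ℓ' => ?_, fun ℓ' => ?_, fun ℓ' => ?_, fun j hj => ?_, fun j hj => ?_⟩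
  · rcases eq_or_ne ℓ' ℓ with rfl | h
    · exact sep
    · rw [hne ℓ' h]; exact hI.sep ℓ'
  · rcases eq_or_ne ℓ' ℓ with rfl | h
    · exact out
    · rw [hne ℓ' h]; exact hI.out ℓ'
  · have h0 := hI.count ℓ'
    rw [Finset.filter_insert, Function.update_self, hfilter]
    rcases eq_or_ne ℓ' ℓ with rfl | h
    · by_cases hκ : κ i = 0
      · simp only [hκ, if_true] at count
        rw [if_neg (by simp [hκ])]
        omega
      · simp only [hκ, if_false] at count
        rw [if_pos ⟨hκ, rfl⟩]
        have := Finset.card_insert_le i (X.filter fun j => κ j ≠ 0 ∧ lev j = ℓ')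
        omega
    · rw [if_neg fun hh => h hh.2.symm, hne ℓ' h]
      have := comps_mono (D := σ.duals ℓ') hFF
      omega
  · rcases Finset.mem_insert.1 hj with rfl | hj
    · rwa [Function.update_self]
    · rw [hlev j hj]; exact hI.cost_le_level j hj
  · rcases Finset.mem_insert.1 hj with rfl | hj
    · exact hd
    · exact hI.cost_le_gdist j hj

lemma OnInv.step [DecidableEq V] (hT : (T : Set (Sym2 V)) ⊆ G.edgeSet) (hI : OnInv G c T r κ σ X lev)
    {i : ℕ} (hi : i ∉ X) (hTi : Connects (T : Set (Sym2 V)) (r i).1 (r i).2)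
    (hκ : κ i = cost c (σ'.F \ σ.F)) (h : OnStep G c σ (r i) σ') :
    ∃ lev', OnInv G c T r κ σ' (insert i X) lev' := by
  have hFF := h.subset
  have hsub := h.subset_edgeSet hI.sub
  generalize hr : r i = q at h
  cases h with
  | free s t p hp h0 =>
    have hκ0 : κ i = 0 := by
      rw [hκ, Finset.union_sdiff_left]
      exact le_antisymm ((cost_walk_sdiff_le p σ.F).trans h0.le) zero_le
    refine ⟨_, hI.extend hi 0 hsub hFF (fun _ _ => rfl) (hI.sep 0) (hI.out 0) ?_
      (fun h => absurd hκ0 h) (by simp [hκ0])⟩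
    have := comps_mono (D := σ.duals 0) hFF
    simp only [hκ0, if_true] at this ⊢
    omega
  | newBall s t p ℓ v hp hpos hℓ hv hball =>
    rw [hr] at hTi
    have hxT : (walkCost (freeOn c σ.F) p : ℝ≥0∞) ≤ gdist G c s t :=
      hp.le_gdist.trans (gdist_mono (freeOn_le c σ.F) s t)
    have hle : κ i ≤ walkCost (freeOn c σ.F) p := by
      rw [hκ, Finset.union_sdiff_left]
      exact cost_walk_sdiff_le p σ.F
    have h2x := zpow_level_le hpos
    have hx2 := lt_zpow_level hpos
    rw [← hℓ] at h2x hx2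
    -- The other terminal is the far point: the discounted path length, at least `2 ^ ℓ`, is a lower
    -- bound for the undiscounted distance.
    have hout : ∃ t', Connects (T : Set (Sym2 V)) v t' ∧
        ((2 ^ ℓ : ℝ≥0) : ℝ≥0∞) ≤ gdist G c v t' := by
      have hd : ((2 ^ ℓ : ℝ≥0) : ℝ≥0∞) ≤ gdist G c s t :=
        le_trans (by exact_mod_cast h2x) hxT
      rcases hv with rfl | rfl
      · exact ⟨t, hTi, hd⟩
      · exact ⟨s, SimpleGraph.Reachable.symm hTi, by rwa [gdist_comm]⟩
    -- A ball of positive radius intersects itself, so a centre already present would violate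
    -- `hball`.
    have hv' : v ∉ σ.duals ℓ := fun hvm => hball v hvm (by
      unfold BallsIntersect
      rw [gdist_self]
      simp only [ENNReal.coe_pos]
      positivity)
    refine ⟨_, hI.extend hi ℓ hsub hFF (fun ℓ' h => Function.update_of_ne h _ _) ?_ ?_ ?_ ?_ ?_⟩
    · simp only [Function.update_self]
      intro a ha b hb hab
      rcases Finset.mem_insert.1 ha with rfl | ha' <;>
        rcases Finset.mem_insert.1 hb with rfl | hb'
      · exact absurd rfl hab
      · exact hball b hb'
      · unfold BallsIntersect
        rw [gdist_comm]
        exact hball a ha'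
      · exact hI.sep ℓ a ha' b hb' hab
    · simp only [Function.update_self]
      intro a ha
      rcases Finset.mem_insert.1 ha with rfl | ha
      · exact hout
      · exact hI.out ℓ a ha
    · simp only [Function.update_self]
      -- The new ball raises the right side of `count` by two, paying for the request and for at
      -- most one new class.
      rw [Finset.card_insert_of_notMem hv']
      have h1 := comps_insert (F := σ.F ∪ p.edges.toFinset) (D := σ.duals ℓ) v
      have h2 := comps_mono (D := σ.duals ℓ) hFF
      dsimp only at h2
      split_ifs <;> omega
    · refine fun _ => ⟨hle.trans (hx2.le.trans ?_), h2x.trans ?_⟩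
      · rw [zpow_add₀ two_ne_zero, zpow_one, mul_comm]
        gcongr
        norm_num
      · exact_mod_cast hxT.trans (gdist_le_cost_of_connects hT hTi)
    · rw [hr]
      calc (κ i : ℝ≥0∞) ≤ walkCost (freeOn c σ.F) p := by exact_mod_cast hle
        _ ≤ gdist G c s t := hxT
        _ ≤ 2 * gdist G c s t := le_mul_of_one_le_left zero_le one_le_two
  | connect s t p ℓ F₁ a₁ a₂ p₁ p₂ hp hpos hℓ hF₁ ha₁ hi₁ ha₂ hi₂ hp₁ hp₂ =>
    rw [hr] at hTi
    have hxT : (walkCost (freeOn c σ.F) p : ℝ≥0∞) ≤ gdist G c s t :=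
      hp.le_gdist.trans (gdist_mono (freeOn_le c σ.F) s t)
    have h2x := zpow_level_le hpos
    have hx2 := lt_zpow_level hpos
    rw [← hℓ] at h2x hx2
    have hpw : ∀ {a z : V} (q : G.Walk a z), IsShortest (freeOn c F₁) q →
        BallsIntersect G c ℓ z a →
        walkCost (freeOn c F₁) q ≤ (2 : ℝ≥0) ^ (ℓ - 2) + 2 ^ (ℓ - 2) := by
      intro a z q hq hi
      have := (hq.le_gdist.trans (gdist_mono (freeOn_le c F₁) a z)).trans
        ((gdist_comm a z).trans_le hi.le)
      exact_mod_cast this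
    -- The edges of `p` are already free when `p₁` and `p₂` are chosen, so the three purchases are
    -- priced separately.
    have hsd : ((F₁ ∪ p₁.edges.toFinset ∪ p₂.edges.toFinset) \ σ.F) ⊆
        (p.edges.toFinset \ σ.F) ∪ (p₁.edges.toFinset \ F₁) ∪ (p₂.edges.toFinset \ F₁) := by
      subst hF₁
      intro e
      simp only [Finset.mem_sdiff, Finset.mem_union]
      tauto
    have hle : κ i ≤ walkCost (freeOn c σ.F) p + 2 ^ ℓ := by
      rw [hκ, ← zpow_sub_two_add ℓ, ← add_assoc]
      refine (cost_mono hsd).trans ((cost_union_le _ _).trans (add_le_add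
        ((cost_union_le _ _).trans (add_le_add (cost_walk_sdiff_le p σ.F)
          ((cost_walk_sdiff_le p₁ F₁).trans (hpw p₁ hp₁ hi₁))))
        ((cost_walk_sdiff_le p₂ F₁).trans (hpw p₂ hp₂ hi₂))))
    -- Were the centres already connected by bought edges, `s` could reach `t` through `a₁` and `a₂`
    -- at discounted cost below four radii, that is below `2 ^ ℓ`, contradicting the level of the
    -- shortest path.
    have hnc : ¬ Connects (σ.F : Set (Sym2 V)) a₁ a₂ := by
      intro hcon
      have h1 : gdist G (freeOn c σ.F) s t < ((2 ^ ℓ : ℝ≥0) : ℝ≥0∞) := by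
        calc gdist G (freeOn c σ.F) s t
            ≤ gdist G (freeOn c σ.F) s a₁ + gdist G (freeOn c σ.F) a₁ t := gdist_triangle _ _ _
          _ ≤ gdist G (freeOn c σ.F) s a₁ +
              (gdist G (freeOn c σ.F) a₁ a₂ + gdist G (freeOn c σ.F) a₂ t) :=
              add_le_add_right (gdist_triangle _ _ _) _
          _ = gdist G (freeOn c σ.F) s a₁ + gdist G (freeOn c σ.F) t a₂ := by
              rw [gdist_eq_zero_of_connects hI.sub hcon, zero_add, gdist_comm a₂ t]
          _ ≤ gdist G c s a₁ + gdist G c t a₂ :=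
              add_le_add (gdist_mono (freeOn_le c σ.F) _ _) (gdist_mono (freeOn_le c σ.F) _ _)
          _ < _ := ENNReal.add_lt_add hi₁ hi₂
          _ = ((2 ^ ℓ : ℝ≥0) : ℝ≥0∞) := by
              rw [← ENNReal.coe_add, zpow_sub_two_add]
      have h2 := hp.le_gdist.trans_lt h1
      rw [ENNReal.coe_lt_coe] at h2
      exact h2.not_ge h2x
    have hcon : Connects ((F₁ ∪ p₁.edges.toFinset ∪ p₂.edges.toFinset : Finset (Sym2 V)) :
        Set (Sym2 V)) a₁ a₂ := by
      refine connects_of_walk ((p₁.append p).append p₂.reverse) fun e he => ?_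
      subst hF₁
      simp only [SimpleGraph.Walk.edges_append, SimpleGraph.Walk.edges_reverse,
        List.mem_append, List.mem_reverse] at he
      simp only [Finset.coe_union, Set.mem_union, Finset.mem_coe, List.mem_toFinset]
      tauto
    refine ⟨_, hI.extend hi ℓ hsub hFF (fun _ _ => rfl) (hI.sep ℓ) (hI.out ℓ) ?_ ?_ ?_⟩
    · have := comps_lt hFF ha₁ ha₂ hcon hnc
      dsimp only at this ⊢
      split_ifs <;> omega
    · refine fun _ => ⟨hle.trans ?_, h2x.trans ?_⟩
      · refine (add_le_add_left hx2.le _).trans ?_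
        rw [zpow_add₀ two_ne_zero, zpow_one]
        calc (2 : ℝ≥0) ^ ℓ * 2 + 2 ^ ℓ = 3 * 2 ^ ℓ := by ring
          _ ≤ 4 * 2 ^ ℓ := by gcongr; norm_num
      · exact_mod_cast hxT.trans (gdist_le_cost_of_connects hT hTi)
    · rw [hr]
      calc (κ i : ℝ≥0∞) ≤ walkCost (freeOn c σ.F) p + walkCost (freeOn c σ.F) p := by
            exact_mod_cast hle.trans (add_le_add_right h2x _)
        _ ≤ gdist G c s t + gdist G c s t := add_le_add hxT hxT
        _ = 2 * gdist G c s t := (two_mul _).symm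

/-- There are at most two requests per ball, and `T` pays `2 ^ (ℓ - 2)` in each of the disjoint
balls; the factor is `2 * 4 = 8`. -/
lemma OnInv.card_level_mul_le (hT : (T : Set (Sym2 V)) ⊆ G.edgeSet)
    (hI : OnInv G c T r κ σ X lev) (ℓ : ℤ) :
    ((X.filter fun i => κ i ≠ 0 ∧ lev i = ℓ).card : ℝ≥0) * 2 ^ ℓ ≤ 8 * cost c T := by
  have hle : (2 : ℝ≥0) ^ (ℓ - 2) ≤ 2 ^ ℓ := zpow_le_zpow_right₀ one_le_two (by omega)
  have h1 := card_mul_le_cost (c := c) (r := 2 ^ (ℓ - 2)) hT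
    (fun a ha b hb hab => not_lt.1 (hI.sep ℓ a ha b hb hab)) fun a ha => by
      obtain ⟨t, h, h'⟩ := hI.out ℓ a ha
      exact ⟨t, h, le_trans (by exact_mod_cast hle) h'⟩
  have h2 : ((X.filter fun i => κ i ≠ 0 ∧ lev i = ℓ).card : ℝ≥0) ≤ 2 * (σ.duals ℓ).card := by
    exact_mod_cast le_trans (Nat.le_add_right _ _) (hI.count ℓ)
  calc _ ≤ 2 * ((σ.duals ℓ).card : ℝ≥0) * 2 ^ ℓ := by gcongr
    _ = 8 * ((σ.duals ℓ).card * 2 ^ (ℓ - 2)) := by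
        rw [← zpow_sub_two_add ℓ]; ring
    _ ≤ 8 * cost c T := by gcongr

end Online

/-- Summation over the levels: if the requests of each level cost `O(x)` in total and each of them
costs `O(x)`, then `m` requests cost `O(x log m)`. -/
lemma sum_le_of_levels {Y : Finset ℕ} {κ : ℕ → ℝ≥0} {lev : ℕ → ℤ} {x : ℝ≥0}
    (h : ∀ i ∈ Y, κ i ≤ 4 * 2 ^ lev i ∧ 2 ^ lev i ≤ x)
    (hcard : ∀ ℓ, ((Y.filter fun i => lev i = ℓ).card : ℝ≥0) * 2 ^ ℓ ≤ 8 * x) :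
    ∑ i ∈ Y, κ i ≤ (4 + 32 * Nat.clog 2 Y.card : ℕ) * x := by
  rcases Y.eq_empty_or_nonempty with rfl | ⟨i₀, hi₀⟩
  · simp
  have hx : 0 < x := lt_of_lt_of_le (by positivity) (h i₀ hi₀).2
  set k := Nat.clog 2 Y.card
  set L := Int.log 2 x
  have hYk : (Y.card : ℝ≥0) ≤ 2 ^ k := by exact_mod_cast Nat.le_pow_clog one_lt_two _
  have hL : (2 : ℝ≥0) ^ L ≤ x := by
    simpa using Int.zpow_log_le_self (b := 2) one_lt_two hx
  have hlevL : ∀ i ∈ Y, lev i ≤ L := fun i hi =>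
    (Int.zpow_le_iff_le_log one_lt_two hx).1 (by simpa using (h i hi).2)
  -- Levels at most `L - k` are negligible: there are at most `2 ^ k` requests, each of cost at most
  -- `4 * 2 ^ (L - k)`. The `k` levels above contribute at most `4 * 8 * x` each.
  rw [← Finset.sum_filter_add_sum_filter_not Y fun i => lev i ≤ L - k]
  push_cast
  rw [add_mul]
  refine add_le_add ?_ ?_
  · calc ∑ i ∈ Y with lev i ≤ L - k, κ i ≤ ∑ i ∈ Y with lev i ≤ L - k, 4 * 2 ^ (L - k) :=
          Finset.sum_le_sum fun i hi => by
            rw [Finset.mem_filter] at hi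
            refine (h i hi.1).1.trans ?_
            gcongr
            · exact one_le_two
            · exact hi.2
      _ ≤ Y.card * (4 * 2 ^ (L - k)) := by
          rw [Finset.sum_const, nsmul_eq_mul]
          gcongr
          exact Finset.filter_subset _ _
      _ ≤ 2 ^ k * (4 * 2 ^ (L - k)) := by gcongr
      _ = 4 * 2 ^ L := by
          rw [zpow_sub₀ two_ne_zero, zpow_natCast]
          field_simp
      _ ≤ 4 * x := by gcongr
  · have hmaps : ∀ i ∈ Y.filter (fun i => ¬ lev i ≤ L - k), lev i ∈ Finset.Ioc (L - k) L :=
      fun i hi => by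
        rw [Finset.mem_filter] at hi
        exact Finset.mem_Ioc.2 ⟨not_le.1 hi.2, hlevL i hi.1⟩
    rw [← Finset.sum_fiberwise_of_maps_to hmaps]
    calc _ ≤ ∑ ℓ ∈ Finset.Ioc (L - k) L, 32 * x := Finset.sum_le_sum fun ℓ _ => by
          calc _ ≤ ∑ i ∈ Y with lev i = ℓ, κ i := Finset.sum_le_sum_of_subset fun i hi => by
                simp only [Finset.mem_filter] at hi ⊢
                exact ⟨hi.1.1, hi.2⟩
            _ ≤ ∑ i ∈ Y with lev i = ℓ, 4 * 2 ^ ℓ := Finset.sum_le_sum fun i hi => by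
                rw [Finset.mem_filter] at hi
                rw [← hi.2]
                exact (h i hi.1).1
            _ = 4 * ((Y.filter fun i => lev i = ℓ).card * 2 ^ ℓ) := by
                rw [Finset.sum_const, nsmul_eq_mul]; ring
            _ ≤ 4 * (8 * x) := by gcongr 4 * ?_; exact hcard ℓ
            _ = 32 * x := by ring
      _ = 32 * k * x := by
          rw [Finset.sum_const, Int.card_Ioc, nsmul_eq_mul]
          simp only [sub_sub_cancel, Int.toNat_natCast]
          ring

/-- The rounding in `clog` costs one extra `log 2`, which `log (m + 2)` absorbs even for `m = 0`;
the constant `120` is not tight. -/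
lemma clog_le_log (m : ℕ) : ((4 + 32 * Nat.clog 2 m : ℕ) : ℝ) ≤ 120 * Real.log (m + 2) := by
  have hl2 := Real.log_two_gt_d9
  have hm : Real.log 2 ≤ Real.log (m + 2) := Real.log_le_log two_pos (by
    linarith [m.cast_nonneg (α := ℝ)])
  have h1 : (Nat.clog 2 m : ℝ) * Real.log 2 ≤ Real.log (m + 2) + Real.log 2 := by
    rcases Nat.lt_or_ge 1 m with h | h
    · have h2 : 2 ^ (Nat.clog 2 m - 1) < m := Nat.pow_pred_clog_lt_self one_lt_two h
      have h3 : ((Nat.clog 2 m - 1 : ℕ) : ℝ) * Real.log 2 ≤ Real.log (m + 2) := by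
        rw [← Real.log_pow]
        apply Real.log_le_log (by positivity)
        have : ((2 : ℝ)) ^ (Nat.clog 2 m - 1) < m := by exact_mod_cast h2
        linarith
      have h4 : (Nat.clog 2 m : ℝ) ≤ ((Nat.clog 2 m - 1 : ℕ) : ℝ) + 1 := by
        exact_mod_cast (by omega : Nat.clog 2 m ≤ Nat.clog 2 m - 1 + 1)
      nlinarith
    · rw [Nat.clog_of_right_le_one h]
      push_cast
      linarith
  push_cast
  nlinarith

/-- The online algorithm is `O(log)`-competitive on every subset of the requests. -/
lemma OnInv.sum_le {V : Type*} {G : SimpleGraph V} {c : Sym2 V → ℝ≥0}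
    {T : Finset (Sym2 V)} {r : ℕ → V × V} {κ : ℕ → ℝ≥0} {σ : OnState V} {X : Finset ℕ}
    {lev : ℕ → ℤ} (hT : (T : Set (Sym2 V)) ⊆ G.edgeSet) (hI : OnInv G c T r κ σ X lev)
    {Y : Finset ℕ} (hY : Y ⊆ X) :
    ((∑ i ∈ Y, κ i : ℝ≥0) : ℝ) ≤ 120 * Real.log (Y.card + 2) * cost c T := by
  have h1 : ∑ i ∈ Y, κ i = ∑ i ∈ Y with κ i ≠ 0, κ i := (Finset.sum_filter_ne_zero _).symm
  have h2 := sum_le_of_levels (Y := Y.filter fun i => κ i ≠ 0) (κ := κ) (lev := lev)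
    (x := cost c T)
    (fun i hi => hI.cost_le_level i (hY (Finset.mem_filter.1 hi).1) (Finset.mem_filter.1 hi).2)
    fun ℓ => by
      -- The level bound for all served requests passes to the subset, so the logarithm sees only
      -- the size of `Y`.
      refine le_trans ?_ (hI.card_level_mul_le hT ℓ)
      gcongr
      rw [Finset.filter_filter]
      exact Finset.filter_subset_filter _ hY
  rw [h1]
  have h3 : ((∑ i ∈ Y with κ i ≠ 0, κ i : ℝ≥0) : ℝ) ≤ _ := NNReal.coe_le_coe.2 h2
  refine h3.trans ?_
  rw [NNReal.coe_mul, NNReal.coe_natCast]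
  gcongr
  refine (clog_le_log _).trans ?_
  gcongr
  exact Finset.filter_subset _ _

/-! ### Serving part of the prediction -/

section Partial

variable {V : Type*} {γ : ℝ≥0} {PC : PCAlgorithm V} {G : SimpleGraph V} {c : Sym2 V → ℝ≥0}
  {Rh : List (V × V)} {u : ℕ}

lemma unsat_le_length (S : Finset (Sym2 V)) : unsat Rh S ≤ Rh.length := List.length_filter_le _ _

lemma unsat_anti {S S' : Finset (Sym2 V)} (h : S ⊆ S') : unsat Rh S' ≤ unsat Rh S := by
  classical
  refine (List.monotone_filter_right Rh fun r hr => ?_).length_le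
  simp only [decide_eq_true_eq] at hr ⊢
  exact fun hc => hr (hc.mono (by exact_mod_cast h))

lemma pcCost_map_const (y : ℝ≥0) (T : Finset (Sym2 V)) :
    pcCost c (Rh.map fun r => (r, y)) T = cost c T + unsat Rh T * y := by
  classical
  simp only [pcCost, unsat, List.filter_map, List.map_map]
  congr 1
  rw [← nsmul_eq_mul, ← List.sum_replicate]
  congr 1
  refine List.eq_replicate_iff.2 ⟨?_, ?_⟩
  · rw [List.length_map]
    congr 1
  · intro b hb
    obtain ⟨a, -, rfl⟩ := List.mem_map.1 hb
    rfl

lemma pcSol_spec (hPC : IsPCApprox γ PC) {T : Finset (Sym2 V)}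
    (hT : (T : Set (Sym2 V)) ⊆ G.edgeSet) (i : ℤ) :
    cost c (pcSol PC G c Rh i) + unsat Rh (pcSol PC G c Rh i) * 2 ^ i
      ≤ γ * (cost c T + unsat Rh T * 2 ^ i) := by
  have := (hPC G c (Rh.map fun r => (r, (2 : ℝ≥0) ^ i))).2 T hT
  rwa [pcCost_map_const, pcCost_map_const] at this

lemma IsPartial.subset_edgeSet (hPC : IsPCApprox γ PC) {S : Finset (Sym2 V)}
    (h : IsPartial γ PC G c Rh u S) : (S : Set (Sym2 V)) ⊆ G.edgeSet := by
  cases h with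
  | empty => simp
  | first => exact (hPC _ _ _).1
  | second => exact (hPC _ _ _).1
  | noLeast => exact (hPC _ _ _).1

/-- The factor two comes from the branch `first`, where only the average of `n_{i-1}` and `n_i` is
known to be at most `γ * u`. -/
lemma IsPartial.unsat_le {S : Finset (Sym2 V)} (h : IsPartial γ PC G c Rh u S) :
    (unsat Rh S : ℝ≥0) ≤ 2 * γ * u := by
  have h2 : γ * u ≤ 2 * γ * u := by
    rw [mul_assoc]
    exact le_mul_of_one_le_left zero_le one_le_two
  cases h with
  | empty h => exact (Nat.cast_le.2 (unsat_le_length _)).trans (h.trans h2)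
  | first i h hi hu =>
    rw [div_le_iff₀ two_pos] at hu
    refine le_self_add.trans (hu.trans_eq ?_)
    ring
  | second i h hi hu => exact le_trans hi.1 h2
  | noLeast i h hb hi h0 => exact le_trans hi h2

lemma exists_two_zpow_mul_lt (a : ℝ≥0) {x : ℝ≥0} (hx : 0 < x) (k : ℤ) :
    ∃ i < k, (2 : ℝ≥0) ^ i * a < x := by
  obtain ⟨n, hn⟩ := exists_nat_gt (a / x)
  rw [div_lt_iff₀ hx] at hn
  have h2n : (n : ℝ≥0) ≤ 2 ^ n := by exact_mod_cast Nat.lt_two_pow_self.le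
  refine ⟨min (-n : ℤ) (k - 1), by omega, ?_⟩
  calc (2 : ℝ≥0) ^ (min (-n : ℤ) (k - 1)) * a ≤ 2 ^ (-n : ℤ) * a := by
        gcongr
        · exact one_le_two
        · exact min_le_left _ _
    _ < x := by
        rw [zpow_neg, zpow_natCast, inv_mul_lt_iff₀ (by positivity)]
        exact hn.trans_le (by gcongr)

/-- A large penalty forces a good output. By integrality a bad output leaves at least `⌊γ * u⌋ + 1`
pairs, hence exceeds `γ * u` by a gap independent of the exponent; this gap times the penalty is at
most `γ * cost c T`, which fails for large penalties. -/
lemma goodExponents_nonempty (hPC : IsPCApprox γ PC) {T : Finset (Sym2 V)}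
    (hT : (T : Set (Sym2 V)) ⊆ G.edgeSet) (hu : unsat Rh T ≤ u) :
    (goodExponents γ PC G c Rh u).Nonempty := by
  by_contra hne
  rw [Set.not_nonempty_iff_eq_empty] at hne
  have hbad : ∀ i, γ * u < unsat Rh (pcSol PC G c Rh i) := fun i => by
    have : i ∉ goodExponents γ PC G c Rh u := by simp [hne]
    exact not_le.1 this
  set m : ℝ≥0 := ((⌊γ * u⌋₊ + 1 : ℕ) : ℝ≥0)
  have hm : γ * u < m := by exact_mod_cast Nat.lt_floor_add_one (γ * (u : ℝ≥0))
  have hmle : ∀ i, m ≤ unsat Rh (pcSol PC G c Rh i) := fun i =>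
    Nat.cast_le.2 ((Nat.floor_lt zero_le).2 (hbad i))
  have hδ : 0 < m - γ * u := tsub_pos_of_lt hm
  obtain ⟨i, -, hi⟩ := exists_two_zpow_mul_lt (γ * cost c T) hδ 0
  have h1 := pcSol_spec (c := c) (Rh := Rh) hPC hT (-i)
  have hp : (0 : ℝ≥0) < 2 ^ (-i) := by positivity
  have h2 : m * 2 ^ (-i) ≤ γ * cost c T + γ * u * 2 ^ (-i) := by
    calc m * 2 ^ (-i) ≤ unsat Rh (pcSol PC G c Rh (-i)) * 2 ^ (-i) := by gcongr; exact hmle _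
      _ ≤ _ := le_add_self.trans h1
      _ ≤ γ * (cost c T + u * 2 ^ (-i)) := by gcongr
      _ = _ := by ring
  have h3 : (m - γ * u) * 2 ^ (-i) ≤ γ * cost c T := by
    rw [tsub_mul]
    exact tsub_le_iff_right.2 h2
  have h4 : (2 : ℝ≥0) ^ i * ((m - γ * u) * 2 ^ (-i)) = m - γ * u := by
    rw [zpow_neg]
    field_simp
  have h5 : (2 : ℝ≥0) ^ i * ((m - γ * u) * 2 ^ (-i)) ≤ 2 ^ i * (γ * cost c T) := by gcongr
  exact (h4 ▸ h5).not_gt hi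

/-- If a solution of cost at most `β` leaves at most `u` pairs unconnected, then `Partial(Rh, u)`
has a result of cost at most `3 * γ * β`. -/
lemma exists_partialWithin [Finite V] (hPC : IsPCApprox γ PC) {T : Finset (Sym2 V)}
    (hT : (T : Set (Sym2 V)) ⊆ G.edgeSet) (hu : unsat Rh T ≤ u) {β : ℝ≥0} (hβ : cost c T ≤ β) :
    ∃ S, PartialWithin γ PC G c Rh β u S := by
  suffices h : ∃ S, IsPartial γ PC G c Rh u S ∧ cost c S ≤ 3 * γ * cost c T by
    obtain ⟨S, hS, hc⟩ := h
    exact ⟨S, hS, hc.trans (by gcongr)⟩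
  rcases le_or_gt (Rh.length : ℝ≥0) (γ * u) with hlen | hlen
  · exact ⟨∅, .empty hlen, by simp [cost]⟩
  have hne := goodExponents_nonempty (c := c) hPC hT hu
  by_cases hb : BddBelow (goodExponents γ PC G c Rh u)
  · obtain ⟨i, hi⟩ : ∃ i, IsLeast (goodExponents γ PC G c Rh u) i := by
      obtain ⟨lb, hlb⟩ := hb
      obtain ⟨i, hi, hle⟩ := Int.exists_least_of_bdd (P := (· ∈ goodExponents γ PC G c Rh u))
        ⟨lb, fun z hz => hlb hz⟩ hne
      exact ⟨i, hi, fun z hz => hle z hz⟩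
    have hpred : γ * u < unsat Rh (pcSol PC G c Rh (i - 1)) := not_le.1 fun h => by
      have := hi.2 (show i - 1 ∈ goodExponents γ PC G c Rh u from h)
      omega
    have h1 := pcSol_spec (c := c) (Rh := Rh) hPC hT (i - 1)
    have h2 := pcSol_spec (c := c) (Rh := Rh) hPC hT i
    have hu' : (unsat Rh T : ℝ≥0) ≤ u := by exact_mod_cast hu
    have hz : (2 : ℝ≥0) ^ i = 2 * 2 ^ (i - 1) := by
      rw [zpow_sub₀ two_ne_zero, zpow_one]; field_simp
    have hp : (0 : ℝ≥0) < 2 ^ (i - 1) := by positivity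
    rw [hz] at h2
    generalize (2 : ℝ≥0) ^ (i - 1) = y at *
    have hγu : γ * unsat Rh T ≤ γ * u := by gcongr
    rcases le_or_gt (((unsat Rh (pcSol PC G c Rh (i - 1)) : ℝ≥0) +
        unsat Rh (pcSol PC G c Rh i)) / 2) (γ * u) with h | h
    -- Since `n_{i-1} > γ * u`, the penalty terms in `h1` can be dropped, leaving even the bound `γ
    -- * cost c T`.
    · refine ⟨_, .first i hlen hi h, ?_⟩
      rw [← NNReal.coe_le_coe] at *
      rw [← NNReal.coe_lt_coe] at *
      push_cast at *
      have hTn : (0 : ℝ) ≤ γ * cost c T := by positivity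
      nlinarith
    -- Write `y` for the smaller penalty. `h2` bounds the cost by `γ * cost c T + 2 * (γ * u - n_i)
    -- * y`. The branch condition gives `γ * u - n_i < n_{i-1} - γ * u`, and `h1` gives `(n_{i-1} -
    -- γ * u) * y ≤ γ * cost c T`. Together this is the factor `3`.
    · refine ⟨_, .second i hlen hi h, ?_⟩
      rw [← NNReal.coe_le_coe] at *
      rw [← NNReal.coe_lt_coe] at *
      push_cast at *
      have hTn : (0 : ℝ) ≤ γ * cost c T := by positivity
      nlinarith
  · have hfin : (Set.range fun S : Finset (Sym2 V) => cost c S).Finite := Set.finite_range _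
    -- Good exponents go arbitrarily far down, so compare with the empty solution at a tiny penalty:
    -- a cost below the least positive cost of an edge set is zero.
    obtain ⟨ε, hε, hmin⟩ : ∃ ε : ℝ≥0, 0 < ε ∧ ∀ S : Finset (Sym2 V), cost c S < ε →
        cost c S = 0 := by
      rcases (Set.range (fun S : Finset (Sym2 V) => cost c S) \ {0}).eq_empty_or_nonempty with h | h
      · refine ⟨1, one_pos, fun S _ => by_contra fun h0 => ?_⟩
        have : cost c S ∈ Set.range (fun S : Finset (Sym2 V) => cost c S) \ {0} := ⟨⟨S, rfl⟩, h0⟩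
        simp [h] at this
      · obtain ⟨ε, ⟨-, hε⟩, hm⟩ := Set.exists_min_image _ id hfin.sdiff h
        exact ⟨ε, pos_iff_ne_zero.2 hε, fun S hS => by_contra fun h0 =>
          (hm _ ⟨⟨S, rfl⟩, h0⟩).not_gt hS⟩
    obtain ⟨k, -, hk⟩ := exists_two_zpow_mul_lt (γ * Rh.length) hε 0
    obtain ⟨i, hi, hik⟩ : ∃ i ∈ goodExponents γ PC G c Rh u, i < k := by
      by_contra! h
      exact hb ⟨k, h⟩
    have hc0 : cost c (pcSol PC G c Rh i) = 0 := by
      refine hmin _ (lt_of_le_of_lt ?_ hk)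
      calc cost c (pcSol PC G c Rh i) ≤ γ * (cost c ∅ + unsat Rh ∅ * 2 ^ i) :=
            le_self_add.trans (pcSol_spec hPC (by simp) i)
        _ = 2 ^ i * (γ * unsat Rh ∅) := by simp [cost]; ring
        _ ≤ 2 ^ k * (γ * Rh.length) := by
          gcongr
          · exact one_le_two
          · exact unsat_le_length _
    exact ⟨_, .noLeast i hlen hb hi hc0, by simp [hc0]⟩

/-- Giving up on all predicted pairs is always affordable, so the search for the least `u` in a
major step terminates. -/
lemma exists_partialWithin_of_length (hγ : 1 ≤ γ) (β : ℝ≥0) :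
    PartialWithin γ PC G c Rh β Rh.length ∅ :=
  ⟨.empty (le_mul_of_one_le_left zero_le hγ), by simp [cost]⟩

end Partial

/-! ### Steiner forest with predictions -/

section Predictions

variable {V : Type*} [DecidableEq V]

/-- A run of the algorithm with predictions: the request `r i` arrives at time `i ∈ act`, and
nothing happens at other times. -/
structure IsSFRun (γ : ℝ≥0) (PC : PCAlgorithm V) (G : SimpleGraph V) (c : Sym2 V → ℝ≥0)
    (Rh : List (V × V)) (σ : ℕ → SFState V) (r : ℕ → V × V) (act : Finset ℕ) (n : ℕ) : Prop where
  init : σ 0 = SFState.init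
  step : ∀ i < n, i ∈ act → SFStep γ PC G c Rh (σ i) (r i) (σ (i + 1))
  idle : ∀ i < n, i ∉ act → σ (i + 1) = σ i

/-- The cost incurred by the online algorithm at time `i`. -/
def costAt (σ : ℕ → SFState V) (i : ℕ) : ℝ≥0 := (σ (i + 1)).B - (σ i).B

/-- `x` is the cost of an online instance which was started on the free edges `S₀`, and which has
served some of the requests. -/
def IsPhaseCost (G : SimpleGraph V) (c : Sym2 V → ℝ≥0) (T : Finset (Sym2 V)) (r : ℕ → V × V)
    (κ : ℕ → ℝ≥0) (act : Finset ℕ) (S₀ : Finset (Sym2 V)) (x : ℝ≥0) : Prop :=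
  ∃ A ⊆ act, ∃ on lev, OnInv G (freeOn c S₀) T r κ on A lev ∧ x = ∑ i ∈ A, κ i

/-- The invariant of the algorithm with predictions at time `i`. -/
structure SFInv (γ : ℝ≥0) (G : SimpleGraph V) (c : Sym2 V → ℝ≥0) (T : Finset (Sym2 V))
    (r : ℕ → V × V) (κ : ℕ → ℝ≥0) (act : Finset ℕ) (τ : SFState V) (i : ℕ) : Prop where
  sub : (τ.S : Set (Sym2 V)) ⊆ G.edgeSet
  sub_free : τ.S₀ ⊆ τ.S
  sub_on : τ.on.F ⊆ τ.S
  cost_le : cost c τ.S ≤ τ.B + 6 * γ * τ.Bh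
  Bh_le : τ.Bh ≤ τ.B
  phase : ∃ A ⊆ act, (∀ j ∈ A, j < i) ∧ ∃ lev, OnInv G (freeOn c τ.S₀) T r κ τ.on A lev ∧
    τ.B = τ.Bh + ∑ j ∈ A, κ j

variable {γ : ℝ≥0} {PC : PCAlgorithm V} {G : SimpleGraph V} {c : Sym2 V → ℝ≥0}
  {Rh : List (V × V)} {σ : ℕ → SFState V} {r : ℕ → V × V} {act : Finset ℕ} {n : ℕ}
  {T : Finset (Sym2 V)}

lemma IsPhaseCost.le_log {κ : ℕ → ℝ≥0} {S₀ : Finset (Sym2 V)} {x : ℝ≥0}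
    (hT : (T : Set (Sym2 V)) ⊆ G.edgeSet) (h : IsPhaseCost G c T r κ act S₀ x) :
    (x : ℝ) ≤ 120 * Real.log (act.card + 2) * cost c T := by
  obtain ⟨A, hA, on, lev, hI, rfl⟩ := h
  refine (hI.sum_le hT subset_rfl).trans ?_
  have h1 : cost (freeOn c S₀) T ≤ cost c T := cost_mono_left (freeOn_le c S₀) T
  have h2 : (0 : ℝ) ≤ Real.log (act.card + 2) := Real.log_nonneg (by
    linarith [act.card.cast_nonneg (α := ℝ)])
  gcongr

/-- Requests which are cheap to serve given the free edges are charged to `m`, and the others to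
the offline solution. -/
lemma IsPhaseCost.le_log_add {κ : ℕ → ℝ≥0} {S₀ : Finset (Sym2 V)} {x D : ℝ≥0}
    (hT : (T : Set (Sym2 V)) ⊆ G.edgeSet) (h : IsPhaseCost G c T r κ act S₀ x)
    {bad : Finset ℕ} {N : ℝ} (hN : (bad.card : ℝ) ≤ N) {m : ℕ → ℝ≥0∞}
    (hm : ∀ i ∈ act, i ∉ bad → gdist G (freeOn c S₀) (r i).1 (r i).2 ≤ m i)
    (hD : ∑ i ∈ act \ bad, m i ≤ D) :
    (x : ℝ) ≤ 120 * Real.log (N + 2) * cost c T + 2 * D := by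
  obtain ⟨A, hA, on, lev, hI, rfl⟩ := h
  have h1 := hI.sum_le hT (Finset.inter_subset_left : A ∩ bad ⊆ A)
  have h2 : cost (freeOn c S₀) T ≤ cost c T := cost_mono_left (freeOn_le c S₀) T
  -- Requests outside `bad` are charged twice their distance given the free edges; those in `bad`
  -- use the subset bound `h1`.
  have h3 : ∑ i ∈ A \ bad, κ i ≤ 2 * D := by
    rw [← ENNReal.coe_le_coe]
    push_cast
    calc ∑ i ∈ A \ bad, (κ i : ℝ≥0∞) ≤ ∑ i ∈ A \ bad, 2 * m i := Finset.sum_le_sum fun i hi => by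
          rw [Finset.mem_sdiff] at hi
          exact (hI.cost_le_gdist i hi.1).trans (by gcongr; exact hm i (hA hi.1) hi.2)
      _ = 2 * ∑ i ∈ A \ bad, m i := (Finset.mul_sum _ _ _).symm
      _ ≤ 2 * ∑ i ∈ act \ bad, m i := by
          gcongr
      _ ≤ 2 * D := by gcongr
  have hcard : ((A ∩ bad).card : ℝ) ≤ N :=
    le_trans (by exact_mod_cast Finset.card_le_card Finset.inter_subset_right) hN
  have h0 : (0 : ℝ) ≤ (A ∩ bad).card := by positivity
  have hlog : Real.log ((A ∩ bad).card + 2) ≤ Real.log (N + 2) :=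
    Real.log_le_log (by positivity) (by linarith)
  have hlog0 : 0 ≤ Real.log ((A ∩ bad).card + 2 : ℝ) := Real.log_nonneg (by linarith)
  have hlogN : 0 ≤ Real.log (N + 2) := hlog0.trans hlog
  rw [← Finset.sum_inter_add_sum_sdiff A bad]
  push_cast at h1 ⊢
  refine add_le_add (h1.trans ?_) (by exact_mod_cast h3)
  gcongr

lemma sfInv_init (γ : ℝ≥0) (G : SimpleGraph V) (c : Sym2 V → ℝ≥0) (T : Finset (Sym2 V))
    (r : ℕ → V × V) (κ : ℕ → ℝ≥0) (act : Finset ℕ) (i : ℕ) :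
    SFInv γ G c T r κ act SFState.init i := by
  refine ⟨by simp [SFState.init], by simp [SFState.init], by simp [SFState.init, OnState.init],
    by simp [SFState.init, cost], le_rfl, ∅, by simp, by simp, fun _ => 0, onInv_init .., ?_⟩
  simp [SFState.init]

/-- The online part of a step, before a possible restart. -/
lemma SFInv.online {κ : ℕ → ℝ≥0} {τ : SFState V} {i : ℕ} (hT : (T : Set (Sym2 V)) ⊆ G.edgeSet)
    (h : SFInv γ G c T r κ act τ i) (hi : i ∈ act)
    (hTi : Connects (T : Set (Sym2 V)) (r i).1 (r i).2) {on' : OnState V}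
    (hon : OnStep G (freeOn c τ.S₀) τ.on (r i) on') (hκ : κ i = τ.newB c on' - τ.B) :
    ∃ A ⊆ act, (∀ j ∈ A, j < i + 1) ∧ ∃ lev, OnInv G (freeOn c τ.S₀) T r κ on' A lev ∧
      τ.newB c on' = τ.Bh + ∑ j ∈ A, κ j := by
  obtain ⟨A, hA, hlt, lev, hI, hB⟩ := h.phase
  have hiA : i ∉ A := fun hh => (hlt i hh).false
  have hκ' : κ i = cost (freeOn c τ.S₀) (on'.F \ τ.on.F) := by
    rw [hκ, SFState.newB, add_tsub_cancel_left]
  obtain ⟨lev', hI'⟩ := hI.step hT hiA hTi hκ' hon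
  refine ⟨insert i A, Finset.insert_subset hi hA, fun j hj => ?_, lev', hI', ?_⟩
  · rcases Finset.mem_insert.1 hj with rfl | hj
    · exact Nat.lt_succ_self _
    · exact (hlt j hj).trans (Nat.lt_succ_self _)
  · rw [Finset.sum_insert hiA, hκ', SFState.newB, hB]
    ring

/-- An edge not yet in `S` is neither free for the instance nor already bought by it, so its full
cost is part of the increase of `B`. -/
lemma SFInv.cost_union_le {κ : ℕ → ℝ≥0} {τ : SFState V} {i : ℕ}
    (h : SFInv γ G c T r κ act τ i) (on' : OnState V) :
    cost c (τ.S ∪ on'.F) ≤ τ.newB c on' + 6 * γ * τ.Bh := by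
  have h1 : cost c (τ.S ∪ on'.F) ≤ cost c τ.S + cost c (on'.F \ τ.S) := by
    rw [← Finset.union_sdiff_self_eq_union]
    exact PSF.cost_union_le _ _
  have h2 : cost c (on'.F \ τ.S) ≤ cost (freeOn c τ.S₀) (on'.F \ τ.on.F) :=
    calc cost c (on'.F \ τ.S) = cost (freeOn c τ.S₀) (on'.F \ τ.S) :=
          Finset.sum_congr rfl fun e he =>
            (if_neg fun hh => (Finset.mem_sdiff.1 he).2 (h.sub_free hh)).symm
      _ ≤ _ := cost_mono (Finset.sdiff_subset_sdiff subset_rfl h.sub_on)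
  calc cost c (τ.S ∪ on'.F) ≤ (τ.B + 6 * γ * τ.Bh) + cost (freeOn c τ.S₀) (on'.F \ τ.on.F) :=
        h1.trans (add_le_add h.cost_le h2)
    _ = τ.newB c on' + 6 * γ * τ.Bh := by rw [SFState.newB]; ring

lemma SFInv.step {κ : ℕ → ℝ≥0} {τ τ' : SFState V} {i : ℕ} (hPC : IsPCApprox γ PC)
    (hT : (T : Set (Sym2 V)) ⊆ G.edgeSet) (h : SFInv γ G c T r κ act τ i) (hi : i ∈ act)
    (hTi : Connects (T : Set (Sym2 V)) (r i).1 (r i).2)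
    (hs : SFStep γ PC G c Rh τ (r i) τ') (hκ : κ i = τ'.B - τ.B) :
    SFInv γ G c T r κ act τ' (i + 1) := by
  cases hs with
  | minor on' hon hB =>
    obtain ⟨A, hA, hlt, lev, hI, hBA⟩ := h.online hT hi hTi hon hκ
    refine ⟨?_, h.sub_free.trans Finset.subset_union_left, Finset.subset_union_right,
      h.cost_union_le on', h.Bh_le.trans le_self_add, A, hA, hlt, lev, hI, hBA⟩
    rw [Finset.coe_union]
    exact Set.union_subset h.sub hI.sub
  | major on' u P hon hB hP hu =>
    obtain ⟨A, hA, hlt, lev, hI, hBA⟩ := h.online hT hi hTi hon hκ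
    refine ⟨?_, subset_rfl, by simp [OnState.init], ?_, le_rfl, ∅, by simp, by simp, fun _ => 0,
      onInv_init .., by simp⟩
    · simp only [Finset.coe_union]
      exact Set.union_subset (Set.union_subset h.sub hI.sub) (hP.1.subset_edgeSet hPC)
    -- A major step has `2 * Bh ≤ B`, so the old term `6 * γ * Bh` is at most `3 * γ * B`; the newly
    -- bought `P` adds another `3 * γ * B`.
    · calc cost c (τ.S ∪ on'.F ∪ P) ≤ (τ.newB c on' + 6 * γ * τ.Bh) + 3 * γ * τ.newB c on' :=
            (PSF.cost_union_le _ _).trans (add_le_add (h.cost_union_le on') hP.2)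
        _ = τ.newB c on' + 3 * γ * (2 * τ.Bh) + 3 * γ * τ.newB c on' := by ring
        _ ≤ τ.newB c on' + 3 * γ * τ.newB c on' + 3 * γ * τ.newB c on' := by gcongr
        _ = τ.newB c on' + 6 * γ * τ.newB c on' := by ring

lemma IsSFRun.sfInv (hPC : IsPCApprox γ PC) (h : IsSFRun γ PC G c Rh σ r act n)
    (hT : (T : Set (Sym2 V)) ⊆ G.edgeSet)
    (hTr : ∀ i ∈ act, Connects (T : Set (Sym2 V)) (r i).1 (r i).2) :
    ∀ i ≤ n, SFInv γ G c T r (costAt σ) act (σ i) i := by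
  intro i
  induction i with
  | zero => intro _; rw [h.init]; exact sfInv_init ..
  | succ i ih =>
    intro hi
    have hI := ih (by omega)
    by_cases ha : i ∈ act
    · exact hI.step hPC hT ha (hTr i ha) (h.step i hi ha) rfl
    · rw [h.idle i hi ha]
      obtain ⟨A, hA, hlt, hh⟩ := hI.phase
      exact ⟨hI.sub, hI.sub_free, hI.sub_on, hI.cost_le, hI.Bh_le, A, hA,
        fun j hj => (hlt j hj).trans (Nat.lt_succ_self _), hh⟩

/-- What a step does to the counters `B` and `Bh` and to the set `S₀` of free edges. -/
lemma IsSFRun.counters [Finite V] (hPC : IsPCApprox γ PC) (h : IsSFRun γ PC G c Rh σ r act n)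
    (hT : (T : Set (Sym2 V)) ⊆ G.edgeSet)
    (hTr : ∀ i ∈ act, Connects (T : Set (Sym2 V)) (r i).1 (r i).2) {i : ℕ} (hi : i < n)
    (ha : i ∈ act) :
    (∃ x, IsPhaseCost G c T r (costAt σ) act (σ i).S₀ x ∧ (σ (i + 1)).B = (σ i).Bh + x) ∧
    (σ (i + 1)).B ≤ (σ i).B + 2 * cost c T ∧
    ((σ (i + 1)).B < 2 * (σ i).Bh ∧ (σ (i + 1)).Bh = (σ i).Bh ∧ (σ (i + 1)).S₀ = (σ i).S₀ ∨
      2 * (σ i).Bh ≤ (σ (i + 1)).B ∧ (σ (i + 1)).Bh = (σ (i + 1)).B ∧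
        (σ i).S₀ ⊆ (σ (i + 1)).S₀ ∧
        ∀ (u₀ : ℕ) (T' : Finset (Sym2 V)), (T' : Set (Sym2 V)) ⊆ G.edgeSet → unsat Rh T' ≤ u₀ →
          cost c T' ≤ (σ (i + 1)).B → (unsat Rh (σ (i + 1)).S₀ : ℝ≥0) ≤ 2 * γ * u₀) := by
  have hI := h.sfInv hPC hT hTr i hi.le
  have hs := h.step i hi ha
  have hκ : costAt σ i = (σ (i + 1)).B - (σ i).B := rfl
  have hTi := hTr i ha
  -- A single request costs at most twice its distance and hence `2 * cost c T`; this limits how far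
  -- `B` can overshoot a threshold in one step.
  have hcost : ∀ on', OnStep G (freeOn c (σ i).S₀) (σ i).on (r i) on' →
      costAt σ i = (σ i).newB c on' - (σ i).B → (σ i).newB c on' ≤ (σ i).B + 2 * cost c T := by
    intro on' hon hκ
    obtain ⟨A₀, -, hlt, lev, hI₀, -⟩ := hI.phase
    have hiA : i ∉ A₀ := fun hh => (hlt i hh).false
    have hκ' : costAt σ i = cost (freeOn c (σ i).S₀) (on'.F \ (σ i).on.F) := by
      rw [hκ, SFState.newB, add_tsub_cancel_left]
    obtain ⟨lev', hI'⟩ := hI₀.step hT hiA hTi hκ' hon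
    have h1 := hI'.cost_le_gdist i (Finset.mem_insert_self _ _)
    have h2 := (gdist_mono (G := G) (freeOn_le c (σ i).S₀) (r i).1 (r i).2).trans
      (gdist_le_cost_of_connects hT hTi)
    have h3 : costAt σ i ≤ 2 * cost c T := by
      rw [← ENNReal.coe_le_coe]
      push_cast
      exact h1.trans (by gcongr)
    rw [SFState.newB, ← hκ']
    gcongr
  generalize hτ : σ (i + 1) = τ' at *
  cases hs with
  | minor on' hon hB =>
    obtain ⟨A, hA, -, lev, hA', hBA⟩ := hI.online hT ha hTi hon hκ
    exact ⟨⟨_, ⟨A, hA, on', lev, hA', rfl⟩, hBA⟩, hcost on' hon hκ, .inl ⟨hB, rfl, rfl⟩⟩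
  | major on' u P hon hB hP hu =>
    obtain ⟨A, hA, -, lev, hA', hBA⟩ := hI.online hT ha hTi hon hκ
    refine ⟨⟨_, ⟨A, hA, on', lev, hA', rfl⟩, hBA⟩, hcost on' hon hκ, .inr ⟨hB, rfl,
      hI.sub_free.trans (Finset.subset_union_left.trans Finset.subset_union_left),
      fun u₀ T' hT' hu₀ hc => ?_⟩⟩
    -- `T'` witnesses that `u₀` is affordable, so the least affordable `u` is no larger.
    have hle : u ≤ u₀ := not_lt.1 fun hlt => hu u₀ hlt (exists_partialWithin hPC hT' hu₀ hc)
    calc (unsat Rh ((σ i).S ∪ on'.F ∪ P) : ℝ≥0) ≤ unsat Rh P :=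
          Nat.cast_le.2 (unsat_anti Finset.subset_union_right)
      _ ≤ 2 * γ * u := hP.1.unsat_le
      _ ≤ 2 * γ * u₀ := by gcongr

/-- The bound without predictions. -/
lemma IsSFRun.B_le_of_phase [Finite V] (hPC : IsPCApprox γ PC) (h : IsSFRun γ PC G c Rh σ r act n)
    (hT : (T : Set (Sym2 V)) ⊆ G.edgeSet)
    (hTr : ∀ i ∈ act, Connects (T : Set (Sym2 V)) (r i).1 (r i).2) {a : ℝ} (ha0 : 0 ≤ a)
    (ha : ∀ S₀ x, IsPhaseCost G c T r (costAt σ) act S₀ x → (x : ℝ) ≤ a) :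
    ((σ n).B : ℝ) ≤ 3 * a := by
  -- At a major step `2 * Bh ≤ B = Bh + x` gives `Bh ≤ x ≤ a`, so the new `Bh` is at most `2 * a`.
  suffices hh : ∀ i ≤ n, ((σ i).Bh : ℝ) ≤ 2 * a ∧ ((σ i).B : ℝ) ≤ (σ i).Bh + a by
    have := hh n le_rfl
    linarith
  intro i
  induction i with
  | zero => intro _; rw [h.init]; simp [SFState.init, ha0]
  | succ i ih =>
    intro hi
    obtain ⟨ih1, ih2⟩ := ih (by omega)
    by_cases hact : i ∈ act
    · obtain ⟨⟨x, hx, hB⟩, -, hcase⟩ := h.counters hPC hT hTr hi hact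
      have hxa := ha _ x hx
      rw [← NNReal.coe_inj] at hB
      push_cast at hB
      rcases hcase with ⟨-, h2, -⟩ | ⟨h1, h2, -⟩
      · rw [h2]; constructor <;> linarith
      · rw [← NNReal.coe_le_coe] at h1
        push_cast at h1
        rw [h2]; constructor <;> linarith
    · rw [h.idle i hi hact]; exact ⟨ih1, ih2⟩

/-- The bound with predictions: once `Bh` exceeds the cost of a solution `T'` for all but `u₀` of
the predicted requests, at most `2 * γ * u₀` of them remain unserved. -/
lemma IsSFRun.B_le_of_prediction [Finite V] (hPC : IsPCApprox γ PC) (h : IsSFRun γ PC G c Rh σ r act n)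
    (hT : (T : Set (Sym2 V)) ⊆ G.edgeSet)
    (hTr : ∀ i ∈ act, Connects (T : Set (Sym2 V)) (r i).1 (r i).2) {a z : ℝ} (ha0 : 0 ≤ a)
    {u₀ : ℕ} {T' : Finset (Sym2 V)} (hT' : (T' : Set (Sym2 V)) ⊆ G.edgeSet)
    (hu₀ : unsat Rh T' ≤ u₀) (hz' : (cost c T' : ℝ) ≤ z) (hz : (cost c T : ℝ) ≤ z)
    (ha : ∀ (S₀ : Finset (Sym2 V)) x, (S₀ : Set (Sym2 V)) ⊆ G.edgeSet →
      (unsat Rh S₀ : ℝ≥0) ≤ 2 * γ * u₀ →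
      IsPhaseCost G c T r (costAt σ) act S₀ x → (x : ℝ) ≤ a) :
    ((σ n).B : ℝ) ≤ 4 * z + 3 * a := by
  have hz0 : 0 ≤ z := le_trans (by positivity) hz
  -- The first alternative is the time before a restart with budget above `z`. The second is the
  -- time after it: the free edges only grow, so few predicted pairs stay unserved, every phase
  -- costs at most `a`, and the doubling argument applies.
  suffices hh : ∀ i ≤ n, (((σ i).Bh : ℝ) ≤ z ∧ ((σ i).B : ℝ) ≤ 2 * z) ∨
      ((unsat Rh (σ i).S₀ : ℝ≥0) ≤ 2 * γ * u₀ ∧ ((σ i).Bh : ℝ) ≤ 4 * z + 2 * a ∧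
        ((σ i).B : ℝ) ≤ (σ i).Bh + a) by
    rcases hh n le_rfl with h | h <;> linarith
  intro i
  induction i with
  | zero => intro _; rw [h.init]; left; simp [SFState.init, hz0]
  | succ i ih =>
    intro hi
    specialize ih (by omega)
    by_cases hact : i ∈ act
    · obtain ⟨⟨x, hx, hB⟩, hBT, hcase⟩ := h.counters hPC hT hTr hi hact
      rw [← NNReal.coe_inj] at hB
      rw [← NNReal.coe_le_coe] at hBT
      push_cast at hB hBT
      rcases ih with ⟨ih1, ih2⟩ | ⟨hun, ih1, ih2⟩
      · rcases hcase with ⟨h1, h2, -⟩ | ⟨h1, h2, -, h4⟩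
        · rw [← NNReal.coe_lt_coe] at h1
          push_cast at h1
          rw [h2]; left; constructor <;> linarith
        · rw [h2]
          rcases le_or_gt ((σ (i + 1)).B : ℝ) z with hle | hlt
          · left; constructor <;> linarith
          · right
            -- The new counter is at most `2 * z + 2 * cost c T ≤ 4 * z`, and it exceeds `z`, so
            -- `T'` fits into the budget.
            refine ⟨h4 u₀ T' hT' hu₀ ?_, by linarith, by linarith⟩
            rw [← NNReal.coe_le_coe]
            linarith
      · have hI := h.sfInv hPC hT hTr i (by omega)
        have hxa := ha _ x ((Finset.coe_subset.2 hI.sub_free).trans hI.sub) hun hx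
        right
        rcases hcase with ⟨-, h2, h3⟩ | ⟨h1, h2, h3, -⟩
        · rw [h2, h3]; exact ⟨hun, ih1, by linarith⟩
        · rw [← NNReal.coe_le_coe] at h1
          push_cast at h1
          rw [h2]
          exact ⟨le_trans (Nat.cast_le.2 (unsat_anti h3)) hun, by linarith, by linarith⟩
    · rw [h.idle i hi hact]; exact ih

lemma SFStep.subset {τ τ' : SFState V} {q : V × V} (hs : SFStep γ PC G c Rh τ q τ') :
    τ.S ⊆ τ'.S := by
  cases hs with
  | minor => exact Finset.subset_union_left
  | major => exact Finset.subset_union_left.trans Finset.subset_union_left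

lemma SFStep.connects {τ τ' : SFState V} {q : V × V} (hs : SFStep γ PC G c Rh τ q τ') :
    Connects (τ'.S : Set (Sym2 V)) q.1 q.2 := by
  cases hs with
  | minor on' hon => exact hon.connects.mono (by simp)
  | major on' u P hon =>
    refine hon.connects.mono ?_
    simp only [Finset.coe_union]
    exact Set.subset_union_right.trans Set.subset_union_left

lemma IsSFRun.subset (h : IsSFRun γ PC G c Rh σ r act n) {i j : ℕ} (hij : i ≤ j) (hj : j ≤ n) :
    (σ i).S ⊆ (σ j).S := by
  induction j, hij using Nat.le_induction with
  | base => exact subset_rfl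
  | succ j hij ih =>
    refine (ih (by omega)).trans ?_
    by_cases ha : j ∈ act
    · exact (h.step j hj ha).subset
    · rw [h.idle j hj ha]

lemma IsSFRun.connects (h : IsSFRun γ PC G c Rh σ r act n) {i : ℕ} (hi : i < n) (ha : i ∈ act) :
    Connects ((σ n).S : Set (Sym2 V)) (r i).1 (r i).2 :=
  (h.step i hi ha).connects.mono (by exact_mod_cast h.subset (j := n) hi le_rfl)

lemma exists_sfStep [Fintype V] (hγ : 1 ≤ γ) (PC : PCAlgorithm V) (G : SimpleGraph V)
    (c : Sym2 V → ℝ≥0) (Rh : List (V × V)) (τ : SFState V) {s t : V} (h : G.Reachable s t) :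
    ∃ τ', SFStep γ PC G c Rh τ (s, t) τ' := by
  classical
  obtain ⟨on', hon⟩ := exists_onStep G (freeOn c τ.S₀) τ.on h
  rcases lt_or_ge (τ.newB c on') (2 * τ.Bh) with hB | hB
  · exact ⟨_, .minor τ (s, t) on' hon hB⟩
  · have hex : ∃ u, ∃ P, PartialWithin γ PC G c Rh (τ.newB c on') u P :=
      ⟨_, _, exists_partialWithin_of_length hγ _⟩
    obtain ⟨P, hP⟩ := Nat.find_spec hex
    exact ⟨_, .major τ (s, t) on' _ P hon hB hP fun u' hu' => Nat.find_min hex hu'⟩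

end Predictions

/-! ### Matching costs -/

section Matching

variable {V : Type*} {b : ℕ} {G : SimpleGraph V} {c : Sym2 V → ℝ≥0} {pr : Sym2 V → Fin b}

lemma mem_edgeSet_levelGraph {j : Fin b} {e : Sym2 V} :
    e ∈ (levelGraph G pr j).edgeSet ↔ e ∈ G.edgeSet ∧ j ≤ pr e := by
  rw [levelGraph, SimpleGraph.edgeSet_fromEdgeSet]
  exact ⟨fun h => h.1, fun h => ⟨h, G.not_isDiag_of_mem_edgeSet h.1⟩⟩

lemma prio_eq_of_matchCost_ne_top {r q : Request V b} (h : matchCost G c pr r q ≠ ⊤) :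
    r.prio = q.prio := by
  by_contra hne
  exact h (if_neg hne)

/-- The edges are those of the two shortest paths that realize the cheaper pairing of terminals;
they extend any connection of `r` to one of `q`. -/
lemma exists_edges_of_matchCost [Fintype V] [DecidableEq V] {r q : Request V b}
    (h : matchCost G c pr r q ≠ ⊤) :
    ∃ W : Finset (Sym2 V), (W : Set (Sym2 V)) ⊆ (levelGraph G pr r.prio).edgeSet ∧
      (cost c W : ℝ≥0∞) ≤ matchCost G c pr r q ∧
      ∀ S : Set (Sym2 V), Connects S r.s r.t → (W : Set (Sym2 V)) ⊆ S → Connects S q.s q.t := by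
  have hw : ∀ {u v : V}, gdist (levelGraph G pr r.prio) c u v ≠ ⊤ →
      ∃ W : Finset (Sym2 V), (W : Set (Sym2 V)) ⊆ (levelGraph G pr r.prio).edgeSet ∧
        (cost c W : ℝ≥0∞) ≤ gdist (levelGraph G pr r.prio) c u v ∧
        ∀ S : Set (Sym2 V), (W : Set (Sym2 V)) ⊆ S → Connects S u v := by
    intro u v huv
    obtain ⟨p, hp⟩ := exists_isShortest c (reachable_of_gdist_ne_top huv)
    refine ⟨p.edges.toFinset, fun e he => p.edges_subset_edgeSet (by simpa using he), ?_,
      fun S hS => connects_of_walk p fun e he => hS (by simpa using he)⟩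
    rw [← walkCost_eq_cost hp.1]
    exact hp.le_gdist
  have hw2 : ∀ {u v u' v' : V}, gdist (levelGraph G pr r.prio) c u v +
        gdist (levelGraph G pr r.prio) c u' v' ≠ ⊤ →
      ∃ W : Finset (Sym2 V), (W : Set (Sym2 V)) ⊆ (levelGraph G pr r.prio).edgeSet ∧
        (cost c W : ℝ≥0∞) ≤ gdist (levelGraph G pr r.prio) c u v +
          gdist (levelGraph G pr r.prio) c u' v' ∧
        ∀ S : Set (Sym2 V), (W : Set (Sym2 V)) ⊆ S → Connects S u v ∧ Connects S u' v' := by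
    intro u v u' v' huv
    rw [ENNReal.add_ne_top] at huv
    obtain ⟨W₁, h1, h2, h3⟩ := hw huv.1
    obtain ⟨W₂, h1', h2', h3'⟩ := hw huv.2
    refine ⟨W₁ ∪ W₂, ?_, ?_, fun S hS => ?_⟩
    · rw [Finset.coe_union]
      exact Set.union_subset h1 h1'
    · refine le_trans ?_ (add_le_add h2 h2')
      exact_mod_cast cost_union_le W₁ W₂
    · rw [Finset.coe_union] at hS
      exact ⟨h3 S (Set.subset_union_left.trans hS), h3' S (Set.subset_union_right.trans hS)⟩
  have hprio := prio_eq_of_matchCost_ne_top h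
  rw [matchCost, if_pos hprio] at h ⊢
  rcases min_choice
    (gdist (levelGraph G pr r.prio) c r.s q.s + gdist (levelGraph G pr r.prio) c r.t q.t)
    (gdist (levelGraph G pr r.prio) c r.s q.t + gdist (levelGraph G pr r.prio) c q.s r.t)
    with hm | hm
  · rw [hm] at h ⊢
    obtain ⟨W, h1, h2, h3⟩ := hw2 h
    refine ⟨W, h1, h2, fun S hS hW => ?_⟩
    obtain ⟨h4, h5⟩ := h3 S hW
    exact (SimpleGraph.Reachable.symm h4).trans (SimpleGraph.Reachable.trans hS h5)
  · rw [hm] at h ⊢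
    obtain ⟨W, h1, h2, h3⟩ := hw2 h
    refine ⟨W, h1, h2, fun S hS hW => ?_⟩
    obtain ⟨h4, h5⟩ := h3 S hW
    exact SimpleGraph.Reachable.trans h5 ((SimpleGraph.Reachable.symm hS).trans h4)

/-- The detour goes from a terminal of `r` to `q`, along the free connection of `q`, and on to the
other terminal; both pairings of terminals are covered since the free connection works in either
direction. -/
lemma gdist_le_matchCost [DecidableEq V] {r q : Request V b} {S : Finset (Sym2 V)}
    (hS : (S : Set (Sym2 V)) ⊆ (levelGraph G pr r.prio).edgeSet)
    (hq : Connects (S : Set (Sym2 V)) q.s q.t) :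
    gdist (levelGraph G pr r.prio) (freeOn c S) r.s r.t ≤ matchCost G c pr r q := by
  unfold matchCost
  split_ifs with hp
  · have hm : ∀ u v, gdist (levelGraph G pr r.prio) (freeOn c S) u v ≤
        gdist (levelGraph G pr r.prio) c u v := fun u v => gdist_mono (freeOn_le c S) u v
    have h0 := gdist_eq_zero_of_connects (c := c) hS hq
    have h0' : gdist (levelGraph G pr r.prio) (freeOn c S) q.t q.s = 0 := by rwa [gdist_comm]
    refine le_min ?_ ?_
    · refine (gdist_triangle r.s q.s r.t).trans (add_le_add (hm _ _) ?_)
      refine (gdist_triangle q.s q.t r.t).trans ?_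
      rw [h0, zero_add, gdist_comm]
      exact hm _ _
    · refine (gdist_triangle r.s q.t r.t).trans (add_le_add (hm _ _) ?_)
      refine (gdist_triangle q.t q.s r.t).trans ?_
      rw [h0', zero_add]
      exact hm _ _
  · exact le_top

lemma length_filter_eq_card {α : Type*} (L : List α) (p : α → Prop) [DecidablePred p] :
    (L.filter fun x => p x).length =
      (Finset.univ.filter fun i : Fin L.length => p (L.get i)).card := by
  induction L with
  | nil => simp
  | cons x L ih =>
    refine Eq.trans ?_
      (Fin.card_filter_univ_succ' fun i : Fin (L.length + 1) => p ((x :: L).get i)).symm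
    change _ = (if p x then 1 else 0) + (Finset.univ.filter fun i => p (L.get i)).card
    rw [← ih]
    by_cases hp : p x <;> simp [hp, add_comm]

open Classical in
lemma unsat_prioClass (Rh : List (Request V b)) (j : Fin b) (S : Finset (Sym2 V)) :
    unsat (prioClass Rh j) S = (Finset.univ.filter fun k : Fin Rh.length =>
      (Rh.get k).prio = j ∧ ¬ Connects (S : Set (Sym2 V)) (Rh.get k).s (Rh.get k).t).card := by
  rw [← length_filter_eq_card Rh fun q => q.prio = j ∧ ¬ Connects (S : Set (Sym2 V)) q.s q.t]
  simp only [unsat, prioClass, List.filter_map, List.length_map, List.filter_filter]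
  congr 1
  refine List.filter_congr fun q _ => ?_
  simp [Bool.and_comm]

end Matching

/-! ### Sums over the priorities -/

/-- Jensen's inequality for the concave logarithm with equal weights `1 / b`. -/
lemma sum_log_le {b : ℕ} (a : Fin b → ℝ) (ha : ∀ j, 0 ≤ a j) :
    ∑ j, Real.log (a j + 2) ≤ b * Real.log ((∑ j, a j) / b + 2) := by
  rcases Nat.eq_zero_or_pos b with rfl | hb
  · simp
  have hb' : (0 : ℝ) < b := by exact_mod_cast hb
  have h := strictConcaveOn_log_Ioi.concaveOn.le_map_sum (t := Finset.univ)
    (w := fun _ : Fin b => (1 / b : ℝ)) (p := fun j => a j + 2) (fun _ _ => by positivity)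
    (by simp [hb'.ne']) fun j _ => Set.mem_Ioi.2 (by have := ha j; positivity)
  simp only [smul_eq_mul, ← Finset.mul_sum, Finset.sum_add_distrib, Finset.sum_const,
    Finset.card_univ, Fintype.card_fin, nsmul_eq_mul] at h
  rw [one_div, inv_mul_le_iff₀ hb'] at h
  refine h.trans_eq ?_
  congr 2
  field_simp

lemma cost_biUnion_le {V ι : Type*} [DecidableEq V] (c : Sym2 V → ℝ≥0) (I : Finset ι)
    (S : ι → Finset (Sym2 V)) : cost c (I.biUnion S) ≤ ∑ j ∈ I, cost c (S j) := by
  classical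
  induction I using Finset.induction_on with
  | empty => simp [cost]
  | insert j I hj ih =>
    rw [Finset.biUnion_insert, Finset.sum_insert hj]
    exact (cost_union_le _ _).trans (add_le_add_right ih _)

/-! ### Runs -/

section Runs

variable {V : Type*} {b : ℕ} {γ : ℝ≥0} {PC : PCAlgorithm V} {G : SimpleGraph V}
  {c : Sym2 V → ℝ≥0} {pr : Sym2 V → Fin b} {R Rh : List (Request V b)}

lemma exists_psfRun [Fintype V] [DecidableEq V] (hγ : 1 ≤ γ) (PC : PCAlgorithm V) (c : Sym2 V → ℝ≥0)
    (Rh : List (Request V b)) (σ : Fin b → SFState V)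
    (hR : ∀ r ∈ R, (levelGraph G pr r.prio).Reachable r.s r.t) :
    ∃ σ', PSFRun γ PC G c pr Rh σ R σ' := by
  induction R generalizing σ with
  | nil => exact ⟨σ, .nil σ⟩
  | cons r R ih =>
    obtain ⟨τ, hτ⟩ := exists_sfStep hγ PC (levelGraph G pr r.prio) c (prioClass Rh r.prio)
      (σ r.prio) (hR r (by simp))
    obtain ⟨σ', hσ'⟩ := ih (Function.update σ r.prio τ) fun q hq => hR q (by simp [hq])
    exact ⟨σ', .cons _ _ _ r R
      ⟨by rwa [Function.update_self], fun j hj => Function.update_of_ne hj _ _⟩ hσ'⟩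

/-- Indexing the states by a common clock lets the run of each priority be read off as an `IsSFRun`
that idles while other priorities are served. -/
lemma PSFRun.exists_states [DecidableEq V] {σ σ' : Fin b → SFState V}
    (h : PSFRun γ PC G c pr Rh σ R σ') :
    ∃ s : ℕ → Fin b → SFState V, s 0 = σ ∧ s R.length = σ' ∧
      ∀ i (hi : i < R.length), PSFStep γ PC G c pr Rh (s i) R[i] (s (i + 1)) := by
  induction h with
  | nil σ => exact ⟨fun _ => σ, rfl, rfl, fun i hi => absurd hi (by simp)⟩
  | cons σ σ' σ'' r R h _ ih =>
    obtain ⟨s, h0, hn, hs⟩ := ih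
    refine ⟨fun i => i.casesOn σ s, rfl, hn, fun i hi => ?_⟩
    cases i with
    | zero => simpa [h0] using h
    | succ i => simpa using hs i (by simpa using hi)

/-- The times at which the requests of priority `j` arrive. -/
def timesOf (R : List (Request V b)) (j : Fin b) : Finset ℕ :=
  (Finset.univ.filter fun i : Fin R.length => (R.get i).prio = j).map Fin.valEmbedding

lemma mem_timesOf {j : Fin b} {i : ℕ} :
    i ∈ timesOf R j ↔ ∃ h : i < R.length, R[i].prio = j := by
  simp only [timesOf, Finset.mem_map, Finset.mem_filter, Finset.mem_univ, true_and,
    Fin.valEmbedding_apply, List.get_eq_getElem]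
  exact ⟨fun ⟨k, hk, hki⟩ => hki ▸ ⟨k.2, hk⟩, fun ⟨h, hp⟩ => ⟨⟨i, h⟩, hp, rfl⟩⟩

/-- The terminal pair of the request at time `i`. -/
def pairAt (R : List (Request V b)) (d : V × V) (i : ℕ) : V × V :=
  if h : i < R.length then (R[i].s, R[i].t) else d

lemma pairAt_of_lt {d : V × V} {i : ℕ} (h : i < R.length) : pairAt R d i = (R[i].s, R[i].t) :=
  dif_pos h

lemma isSFRun_of_states [DecidableEq V] {s : ℕ → Fin b → SFState V} (h0 : s 0 = fun _ => SFState.init)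
    (hs : ∀ i (hi : i < R.length), PSFStep γ PC G c pr Rh (s i) R[i] (s (i + 1))) (d : V × V)
    (j : Fin b) :
    IsSFRun γ PC (levelGraph G pr j) c (prioClass Rh j) (fun i => s i j) (pairAt R d)
      (timesOf R j) R.length := by
  refine ⟨by simp [h0], fun i hi ha => ?_, fun i hi ha => ?_⟩
  · obtain ⟨-, rfl⟩ := mem_timesOf.1 ha
    rw [pairAt_of_lt hi]
    exact (hs i hi).1
  · exact (hs i hi).2 j fun h => ha (mem_timesOf.2 ⟨hi, h.symm⟩)

end Runs

/-! ### Using the matching within one priority -/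

section Error

variable {V : Type*} {b : ℕ} {γ : ℝ≥0} {PC : PCAlgorithm V} {G : SimpleGraph V}
  {c : Sym2 V → ℝ≥0} {pr : Sym2 V → Fin b} {R Rh : List (Request V b)}
  {M : Finset (Fin R.length)} {Mh : Finset (Fin Rh.length)} {j : Fin b} {T : Finset (Sym2 V)}

/-- The matching cost of the `i`-th request, which is zero if it is not matched. -/
noncomputable def matchedCost (G : SimpleGraph V) (c : Sym2 V → ℝ≥0) (pr : Sym2 V → Fin b)
    (e : M ≃ Mh) (i : Fin R.length) : ℝ≥0∞ :=
  if h : i ∈ M then matchCost G c pr (R.get i) (Rh.get (e ⟨i, h⟩).1) else 0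

lemma sum_matchedCost (e : M ≃ Mh) :
    ∑ i, matchedCost G c pr e i = ∑ i : M, matchCost G c pr (R.get i.1) (Rh.get (e i).1) := by
  calc ∑ i, matchedCost G c pr e i = ∑ i ∈ M, matchedCost G c pr e i :=
        (Finset.sum_subset (Finset.subset_univ M) fun i _ hi => dif_neg hi).symm
    _ = ∑ i : M, matchedCost G c pr e i := (Finset.sum_coe_sort M _).symm
    _ = _ := Finset.sum_congr rfl fun i _ => dif_pos i.2

/-- The number of positions of priority `j` outside `M`. -/
def outliers (L : List (Request V b)) (M : Finset (Fin L.length)) (j : Fin b) : ℕ :=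
  (Mᶜ.filter fun i => (L.get i).prio = j).card

lemma sum_outliers (L : List (Request V b)) (M : Finset (Fin L.length)) :
    ∑ j, outliers L M j = Mᶜ.card :=
  (Finset.card_eq_sum_card_fiberwise fun _ _ => Finset.mem_coe.2 (Finset.mem_univ _)).symm

/-- An offline solution and the matching paths serve the matched part of the prediction. -/
lemma exists_solution_of_matching [Fintype V] [DecidableEq V]
    (hT : (T : Set (Sym2 V)) ⊆ (levelGraph G pr j).edgeSet)
    (hTR : ∀ r ∈ R, r.prio = j → Connects (T : Set (Sym2 V)) r.s r.t) (e : M ≃ Mh)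
    (hfin : ∀ i, matchedCost G c pr e i ≠ ⊤) :
    ∃ T' : Finset (Sym2 V), (T' : Set (Sym2 V)) ⊆ (levelGraph G pr j).edgeSet ∧
      unsat (prioClass Rh j) T' ≤ outliers Rh Mh j ∧
      (cost c T' : ℝ≥0∞) ≤ cost c T + ∑ i with (R.get i).prio = j, matchedCost G c pr e i := by
  classical
  have hW : ∀ i : Fin R.length, ∃ W : Finset (Sym2 V), (R.get i).prio = j →
      (W : Set (Sym2 V)) ⊆ (levelGraph G pr j).edgeSet ∧
      (cost c W : ℝ≥0∞) ≤ matchedCost G c pr e i ∧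
      ∀ (h : i ∈ M) (S : Set (Sym2 V)), Connects S (R.get i).s (R.get i).t →
        (W : Set (Sym2 V)) ⊆ S → Connects S (Rh.get (e ⟨i, h⟩).1).s (Rh.get (e ⟨i, h⟩).1).t := by
    intro i
    by_cases h : i ∈ M
    · have hne := hfin i
      rw [matchedCost, dif_pos h] at hne
      obtain ⟨W, h1, h2, h3⟩ := exists_edges_of_matchCost hne
      refine ⟨W, fun hj => ⟨hj ▸ h1, ?_, fun _ => h3⟩⟩
      rwa [matchedCost, dif_pos h]
    · exact ⟨∅, fun _ => ⟨by simp, by simp [cost], fun h' => absurd h' h⟩⟩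
  choose W hW using hW
  set I : Finset (Fin R.length) := Finset.univ.filter fun i => (R.get i).prio = j
  have hI : ∀ i ∈ I, (R.get i).prio = j := fun i hi => (Finset.mem_filter.1 hi).2
  refine ⟨T ∪ I.biUnion W, ?_, ?_, ?_⟩
  · rw [Finset.coe_union, Finset.coe_biUnion]
    exact Set.union_subset hT (Set.iUnion₂_subset fun i hi => (hW i (hI i hi)).1)
  · rw [unsat_prioClass]
    -- A matched predicted pair is connected through its partner request, whose finite matching cost
    -- forces the same priority; so only outliers can remain unserved.
    refine Finset.card_le_card fun k hk => ?_
    simp only [Finset.mem_filter, Finset.mem_univ, true_and, Finset.mem_compl] at hk ⊢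
    refine ⟨fun hkM => hk.2 ?_, hk.1⟩
    obtain ⟨i, hi⟩ := e.surjective ⟨k, hkM⟩
    have hprio : (R.get i.1).prio = j := by
      have hne := hfin i.1
      rw [matchedCost, dif_pos i.2, hi] at hne
      rw [prio_eq_of_matchCost_ne_top hne, hk.1]
    have h3 := (hW i.1 hprio).2.2 i.2 ((T ∪ I.biUnion W : Finset (Sym2 V)) : Set (Sym2 V))
      ((hTR _ (List.get_mem _ _) hprio).mono (by simp)) (by
        exact_mod_cast (Finset.subset_biUnion_of_mem W
          (Finset.mem_filter.2 ⟨Finset.mem_univ i.1, hprio⟩)).trans Finset.subset_union_right)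
    have hsub : e ⟨i.1, i.2⟩ = ⟨k, hkM⟩ := hi
    rwa [hsub] at h3
  · calc (cost c (T ∪ I.biUnion W) : ℝ≥0∞) ≤ ((cost c T + ∑ i ∈ I, cost c (W i) : ℝ≥0) : ℝ≥0∞) :=
          ENNReal.coe_le_coe.2 ((cost_union_le _ _).trans
            (add_le_add_right (cost_biUnion_le c I W) _))
      _ = cost c T + ∑ i ∈ I, (cost c (W i) : ℝ≥0∞) := by push_cast; rfl
      _ ≤ _ := by
        gcongr with i hi
        exact (hW i (hI i hi)).2.1

/-- The cost of an online instance which was started on free edges `S₀` that leave few predicted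
requests unserved. -/
lemma IsPhaseCost.le_of_matching [DecidableEq V] {κ : ℕ → ℝ≥0} {S₀ : Finset (Sym2 V)} {x D : ℝ≥0}
    {d : V × V} (hT : (T : Set (Sym2 V)) ⊆ (levelGraph G pr j).edgeSet)
    (h : IsPhaseCost (levelGraph G pr j) c T (pairAt R d) κ (timesOf R j) S₀ x)
    (hS₀ : (S₀ : Set (Sym2 V)) ⊆ (levelGraph G pr j).edgeSet) (e : M ≃ Mh)
    (hfin : ∀ i, matchedCost G c pr e i ≠ ⊤)
    (hun : (unsat (prioClass Rh j) S₀ : ℝ≥0) ≤ 2 * γ * outliers Rh Mh j)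
    (hD : ∑ i with (R.get i).prio = j, matchedCost G c pr e i ≤ D) :
    (x : ℝ) ≤ 120 * Real.log ((outliers R M j + 2 * γ * outliers Rh Mh j : ℝ) + 2) * cost c T
      + 2 * D := by
  classical
  set I : Finset (Fin R.length) := Finset.univ.filter fun i => (R.get i).prio = j
  set bad₁ : Finset (Fin R.length) := Mᶜ.filter fun i => (R.get i).prio = j
  set bad₂ : Finset (Fin R.length) := I.filter fun i => ∃ h : i ∈ M,
    ¬ Connects (S₀ : Set (Sym2 V)) (Rh.get (e ⟨i, h⟩).1).s (Rh.get (e ⟨i, h⟩).1).t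
  -- The matching sends each of these requests injectively to an unserved predicted position of
  -- priority `j`.
  have hbad₂ : bad₂.card ≤ unsat (prioClass Rh j) S₀ := by
    rw [unsat_prioClass]
    refine Finset.card_le_card_of_forall_subsingleton
      (fun i k => ∃ h : i ∈ M, (e ⟨i, h⟩).1 = k) (fun i hi => ?_) fun k _ => ?_
    · simp only [bad₂, I, Finset.mem_filter, Finset.mem_univ, true_and] at hi
      obtain ⟨hj, hM, hc⟩ := hi
      have hne := hfin i
      rw [matchedCost, dif_pos hM] at hne
      refine ⟨(e ⟨i, hM⟩).1, ?_, hM, rfl⟩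
      simp only [Finset.mem_filter, Finset.mem_univ, true_and]
      exact ⟨by rw [← prio_eq_of_matchCost_ne_top hne, hj], hc⟩
    · rintro i ⟨-, hi, hik⟩ i' ⟨-, hi', hik'⟩
      have := e.injective (Subtype.ext (hik.trans hik'.symm))
      exact congrArg Subtype.val this
  have hcard : (((bad₁ ∪ bad₂).map Fin.valEmbedding).card : ℝ) ≤
      outliers R M j + 2 * γ * outliers Rh Mh j := by
    rw [Finset.card_map]
    have h1 : ((bad₁ ∪ bad₂).card : ℝ) ≤ bad₁.card + bad₂.card := by
      exact_mod_cast Finset.card_union_le _ _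
    have h2 : (bad₂.card : ℝ) ≤ unsat (prioClass Rh j) S₀ := by exact_mod_cast hbad₂
    have h3 : (unsat (prioClass Rh j) S₀ : ℝ) ≤ 2 * γ * outliers Rh Mh j := by exact_mod_cast hun
    have h4 : (bad₁.card : ℝ) = outliers R M j := rfl
    linarith
  refine h.le_log_add hT hcard
    (m := fun i => if hi : i < R.length then matchedCost G c pr e ⟨i, hi⟩ else 0)
    (fun i hi hib => ?_) ?_
  · obtain ⟨hlt, hj⟩ := mem_timesOf.1 hi
    have hnb : ⟨i, hlt⟩ ∉ bad₁ ∪ bad₂ := fun hh =>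
      hib (Finset.mem_map.2 ⟨⟨i, hlt⟩, hh, rfl⟩)
    rw [Finset.mem_union, not_or] at hnb
    simp only [bad₁, bad₂, I, Finset.mem_filter, Finset.mem_compl, Finset.mem_univ, true_and,
      List.get_eq_getElem, hj, and_true, not_not] at hnb
    obtain ⟨hM, hc⟩ := hnb
    rw [dif_pos hlt, pairAt_of_lt hlt, matchedCost, dif_pos hM]
    have hcon : Connects (S₀ : Set (Sym2 V)) (Rh.get (e ⟨⟨i, hlt⟩, hM⟩).1).s
        (Rh.get (e ⟨⟨i, hlt⟩, hM⟩).1).t := by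
      by_contra hn
      exact hc ⟨hM, hn⟩
    subst hj
    exact gdist_le_matchCost (r := R.get ⟨i, hlt⟩) hS₀ hcon
  · refine le_trans ?_ hD
    refine (Finset.sum_le_sum_of_subset Finset.sdiff_subset).trans_eq ?_
    rw [timesOf, Finset.sum_map]
    exact Finset.sum_congr rfl fun i _ => by simp

end Error

/-- Since `log (x + 2) ≥ log 2 ≥ 1 / 2`, the additive `log k` becomes a multiplicative constant;
this moves the factor `2 * γ + 1` out of the logarithm. -/
lemma log_mul_add_two_le {k x : ℝ} (hk : 1 ≤ k) (hx : 0 ≤ x) :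
    Real.log (k * x + 2) ≤ (1 + 2 * Real.log k) * Real.log (x + 2) := by
  have h2 := Real.log_two_gt_d9
  have h3 : Real.log 2 ≤ Real.log (x + 2) := Real.log_le_log two_pos (by linarith)
  have h4 : 0 ≤ Real.log k := Real.log_nonneg hk
  calc Real.log (k * x + 2) ≤ Real.log (k * (x + 2)) :=
        Real.log_le_log (by positivity) (by linarith)
    _ = Real.log k + Real.log (x + 2) := Real.log_mul (by positivity) (by positivity)
    _ ≤ _ := by nlinarith

/-- The bound for the instance of priority `j`. -/
lemma IsSFRun.B_le {V : Type*} [Fintype V] [DecidableEq V] {b : ℕ} {γ : ℝ≥0} {PC : PCAlgorithm V}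
    {G : SimpleGraph V} {c : Sym2 V → ℝ≥0} {pr : Sym2 V → Fin b} {R Rh : List (Request V b)}
    {M : Finset (Fin R.length)} {Mh : Finset (Fin Rh.length)} {j : Fin b} {T : Finset (Sym2 V)}
    (hγ : 1 ≤ γ) (hPC : IsPCApprox γ PC) {σ : ℕ → SFState V} {d : V × V}
    (h : IsSFRun γ PC (levelGraph G pr j) c (prioClass Rh j) σ (pairAt R d) (timesOf R j) R.length)
    (hT : (T : Set (Sym2 V)) ⊆ (levelGraph G pr j).edgeSet)
    (hTR : ∀ r ∈ R, r.prio = j → Connects (T : Set (Sym2 V)) r.s r.t) (e : M ≃ Mh)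
    (hfin : ∀ i, matchedCost G c pr e i ≠ ⊤) {D : ℝ≥0}
    (hD : ∑ i with (R.get i).prio = j, matchedCost G c pr e i = D) :
    ((σ R.length).B : ℝ) ≤ 368 * (1 + 2 * Real.log (2 * γ + 1)) *
      (Real.log (min ((timesOf R j).card : ℝ) (outliers R M j + outliers Rh Mh j : ℝ) + 2) *
        cost c T + D) := by
  have hTr : ∀ i ∈ timesOf R j, Connects (T : Set (Sym2 V)) (pairAt R d i).1 (pairAt R d i).2 := by
    intro i hi
    obtain ⟨hlt, hj⟩ := mem_timesOf.1 hi
    rw [pairAt_of_lt hlt]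
    exact hTR _ (List.getElem_mem hlt) hj
  have hγ' : (1 : ℝ) ≤ γ := by exact_mod_cast hγ
  have hlogγ : 0 ≤ Real.log (2 * γ + 1) := Real.log_nonneg (by linarith)
  have hTn : (0 : ℝ) ≤ cost c T := NNReal.coe_nonneg _
  have hDn : (0 : ℝ) ≤ D := NNReal.coe_nonneg _
  have h2 := Real.log_two_gt_d9
  have hlog : ∀ x : ℝ, 0 ≤ x → 1 / 2 ≤ Real.log (x + 2) := fun x hx =>
    le_trans (by linarith) (Real.log_le_log two_pos (by linarith : 2 ≤ x + 2))
  rcases min_choice ((timesOf R j).card : ℝ) (outliers R M j + outliers Rh Mh j : ℝ)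
    with hm | hm <;> rw [hm]
  · have hl := hlog ((timesOf R j).card : ℝ) (by positivity)
    have h1 := h.B_le_of_phase hPC hT hTr
      (a := 120 * Real.log ((timesOf R j).card + 2) * cost c T) (by positivity)
      fun S₀ x hx => hx.le_log hT
    calc _ ≤ 368 * 1 * (Real.log ((timesOf R j).card + 2) * cost c T + D) := by
          have : 0 ≤ Real.log ((timesOf R j).card + 2) * (cost c T : ℝ) := by positivity
          linarith
      _ ≤ _ := by gcongr; linarith
  · set Δ : ℝ := outliers R M j + outliers Rh Mh j with hΔ
    have hΔ0 : 0 ≤ Δ := by positivity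
    have hl := hlog Δ hΔ0
    obtain ⟨T', hT', hun, hcost⟩ := exists_solution_of_matching (c := c) hT hTR e hfin
    rw [hD] at hcost
    have hcost' : (cost c T' : ℝ) ≤ cost c T + D := by exact_mod_cast hcost
    have hk : (outliers R M j + 2 * γ * outliers Rh Mh j : ℝ) ≤ (2 * γ + 1) * Δ := by
      have h3 : (0 : ℝ) ≤ outliers R M j := by positivity
      have h4 : (0 : ℝ) ≤ outliers Rh Mh j := by positivity
      rw [hΔ]
      nlinarith
    have hlogk : Real.log ((outliers R M j + 2 * γ * outliers Rh Mh j : ℝ) + 2) ≤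
        (1 + 2 * Real.log (2 * γ + 1)) * Real.log (Δ + 2) :=
      (Real.log_le_log (by positivity) (by linarith)).trans
        (log_mul_add_two_le (by linarith) hΔ0)
    set K := 1 + 2 * Real.log (2 * γ + 1)
    have hK : 1 ≤ K := by linarith
    have h1 := h.B_le_of_prediction hPC hT hTr (z := cost c T + D)
      (a := 120 * (K * Real.log (Δ + 2)) * cost c T + 2 * D) (by positivity) hT' hun hcost'
      (by linarith) fun S₀ x hS₀ hunS hx =>
        (hx.le_of_matching hT hS₀ e hfin hunS hD.le).trans (by gcongr)
    refine h1.trans ?_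
    -- The target constant is `368 = 3 * 120 + 8`: the phases give `360`, and `4 * cost c T` from
    -- the threshold gives `8` by this estimate. The total coefficient of `D` is only `4 + 6 = 10`.
    have h5 : (cost c T : ℝ) ≤ 2 * (K * (Real.log (Δ + 2) * cost c T)) := by
      have h6 : (1 : ℝ) / 2 ≤ K * Real.log (Δ + 2) := by nlinarith
      nlinarith
    have h7 : (D : ℝ) ≤ K * D := le_mul_of_one_le_left hDn hK
    nlinarith

end PSF

/-! ### Combining the priorities -/

theorem mainTheorem5 (γ : ℝ≥0) (hγ : 1 ≤ γ) :
    ∃ C : ℝ, 0 < C ∧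
      ∀ (V : Type*) [Fintype V] [DecidableEq V] (b : ℕ) (G : SimpleGraph V) (c : Sym2 V → ℝ≥0)
        (pr : Sym2 V → Fin b) (PC : PSF.PCAlgorithm V), PSF.IsPCApprox γ PC →
      ∀ (R Rh : List (PSF.Request V b)) (OPT : ℝ≥0), PSF.IsOptCost G c pr R OPT →
        (∃ S, PSF.IsOutput γ PC G c pr Rh R S) ∧
        ∀ S, PSF.IsOutput γ PC G c pr Rh R S →
          PSF.IsFeasible G pr R S ∧
          ∀ (Δ : ℕ) (D : ℝ≥0), PSF.IsMetricError G c pr R Rh Δ D →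
            (PSF.cost c S : ℝ) ≤
              C * ((b : ℝ) * Real.log (min (R.length : ℝ) (Δ : ℝ) / (b : ℝ) + 2)) * (OPT : ℝ)
                + C * (D : ℝ) := by
  have hγ' : (1 : ℝ) ≤ γ := by exact_mod_cast hγ
  have hlogγ : 0 ≤ Real.log (2 * γ + 1) := Real.log_nonneg (by linarith)
  -- The factor `1 + 6 * γ` passes from the counter `B` to the cost of the solution; the rest is the
  -- constant of `IsSFRun.B_le`.
  refine ⟨(1 + 6 * γ) * (368 * (1 + 2 * Real.log (2 * γ + 1))), by positivity, ?_⟩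
  intro V _ _ b G c pr PC hPC R Rh OPT ⟨⟨T, ⟨hTG, hTR⟩, hTc⟩, _⟩
  -- the part of the optimal solution which is used at priority `j`
  set Tj : Fin b → Finset (Sym2 V) := fun j => T.filter fun e => j ≤ pr e
  have hTj : ∀ j, (Tj j : Set (Sym2 V)) ⊆ (PSF.levelGraph G pr j).edgeSet := fun j e he => by
    have he' := Finset.mem_filter.1 (Finset.mem_coe.1 he)
    exact PSF.mem_edgeSet_levelGraph.2 ⟨hTG he'.1, he'.2⟩
  have hTjR : ∀ j, ∀ r ∈ R, r.prio = j → PSF.Connects (Tj j : Set (Sym2 V)) r.s r.t := by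
    rintro j r hr rfl
    refine (hTR r hr).mono fun e he => ?_
    exact Finset.mem_coe.2 (Finset.mem_filter.2 he)
  have hTjc : ∀ j, PSF.cost c (Tj j) ≤ OPT := fun j =>
    hTc ▸ PSF.cost_mono (Finset.filter_subset _ _)
  constructor
  · obtain ⟨σ, hσ⟩ := PSF.exists_psfRun (G := G) (pr := pr) (R := R) hγ PC c Rh
      (fun _ => PSF.SFState.init) fun r hr => by
        obtain ⟨p, -⟩ := PSF.exists_isPath_of_connects (hTj r.prio) (hTjR _ r hr rfl)
        exact ⟨p⟩
    exact ⟨_, σ, hσ, rfl⟩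
  rintro S ⟨σ, hσ, rfl⟩
  obtain ⟨s, h0, rfl, hs⟩ := hσ.exists_states
  -- `pairAt` needs a default pair, and `V` may be empty; a nonempty request list supplies one.
  rcases R.eq_nil_or_concat with hnil | ⟨R', r₀, hR'⟩
  · have hS : (Finset.univ.biUnion fun j => (s R.length j).S) = ∅ := by
      subst hnil
      exact Finset.eq_empty_of_forall_notMem fun e he => by
        obtain ⟨j, -, he⟩ := Finset.mem_biUnion.1 he
        rw [List.length_nil, h0] at he
        exact absurd he (Finset.notMem_empty e)
    rw [hS]
    refine ⟨⟨by simp, by simp [hnil]⟩, fun Δ D _ => ?_⟩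
    have : 0 ≤ Real.log (min (R.length : ℝ) (Δ : ℝ) / (b : ℝ) + 2) :=
      Real.log_nonneg (by
        have : 0 ≤ min (R.length : ℝ) (Δ : ℝ) / (b : ℝ) := by positivity
        linarith)
    simp only [PSF.cost, Finset.sum_empty, NNReal.coe_zero]
    positivity
  have hrun := fun j => PSF.isSFRun_of_states h0 hs (r₀.s, r₀.t) j
  have hTr : ∀ j, ∀ i ∈ PSF.timesOf R j, PSF.Connects (Tj j : Set (Sym2 V))
      (PSF.pairAt R (r₀.s, r₀.t) i).1 (PSF.pairAt R (r₀.s, r₀.t) i).2 := by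
    intro j i hi
    obtain ⟨hlt, hj⟩ := PSF.mem_timesOf.1 hi
    rw [PSF.pairAt_of_lt hlt]
    exact hTjR j _ (List.getElem_mem hlt) hj
  have hinv := fun j => (hrun j).sfInv hPC (hTj j) (hTr j) R.length le_rfl
  constructor
  · constructor
    · intro e he
      simp only [Finset.coe_biUnion, Set.mem_iUnion] at he
      obtain ⟨j, -, he⟩ := he
      exact (PSF.mem_edgeSet_levelGraph.1 ((hinv j).sub he)).1
    · intro r hr
      obtain ⟨i, hi, rfl⟩ := List.mem_iff_getElem.1 hr
      have hcon := (hrun R[i].prio).connects hi (PSF.mem_timesOf.2 ⟨hi, rfl⟩)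
      rw [PSF.pairAt_of_lt hi] at hcon
      refine hcon.mono fun e he => ⟨?_, ?_⟩
      · exact Finset.mem_biUnion.2 ⟨_, Finset.mem_univ _, he⟩
      · exact (PSF.mem_edgeSet_levelGraph.1 ((hinv R[i].prio).sub he)).2
  rintro Δ D ⟨M, Mh, -, ⟨⟨e, he⟩, -⟩, hΔ⟩
  have he' : ∑ i, PSF.matchedCost G c pr e i = D := (PSF.sum_matchedCost e).trans he
  have hfin : ∀ i, PSF.matchedCost G c pr e i ≠ ⊤ := fun i =>
    ne_top_of_le_ne_top (he' ▸ ENNReal.coe_ne_top)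
      (Finset.single_le_sum (f := PSF.matchedCost G c pr e) (fun _ _ => zero_le)
        (Finset.mem_univ i))
  -- A finite matching respects priorities, so its cost is split exactly among them.
  set Dj : Fin b → ℝ≥0 := fun j =>
    (∑ i with (R.get i).prio = j, PSF.matchedCost G c pr e i).toNNReal
  have hDj : ∀ j, ∑ i with (R.get i).prio = j, PSF.matchedCost G c pr e i = (Dj j : ℝ≥0∞) :=
    fun j => (ENNReal.coe_toNNReal (ENNReal.sum_ne_top.2 fun i _ => hfin i)).symm
  have hDsum : ∑ j, (Dj j : ℝ) = D := by
    have h1 : ∑ j, (Dj j : ℝ≥0∞) = D := by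
      rw [← he', ← Finset.sum_fiberwise Finset.univ fun i => (R.get i).prio]
      exact Finset.sum_congr rfl fun j _ => (hDj j).symm
    exact_mod_cast h1
  set K := 368 * (1 + 2 * Real.log (2 * γ + 1))
  have hK : 0 ≤ K := by positivity
  -- The better of the two bounds is taken for each priority separately; the sum of the minima is at
  -- most the minimum of the sums `|R|` and `Δ`.
  set a : Fin b → ℝ := fun j => min ((PSF.timesOf R j).card : ℝ)
    (PSF.outliers R M j + PSF.outliers Rh Mh j : ℝ)
  have ha : ∀ j, 0 ≤ a j := fun j => le_min (Nat.cast_nonneg _)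
    (add_nonneg (Nat.cast_nonneg _) (Nat.cast_nonneg _))
  have hcost : ∀ j, (PSF.cost c (s R.length j).S : ℝ) ≤
      (1 + 6 * γ) * (K * (Real.log (a j + 2) * OPT + Dj j)) := by
    intro j
    have h1 := (hrun j).B_le hγ hPC (hTj j) (hTjR j) e hfin (hDj j)
    have h2 : PSF.cost c (s R.length j).S ≤ (1 + 6 * γ) * (s R.length j).B :=
      (hinv j).cost_le.trans (by
        rw [add_mul, one_mul]
        have := (hinv j).Bh_le
        gcongr)
    have h3 : (PSF.cost c (s R.length j).S : ℝ) ≤ (1 + 6 * γ) * (s R.length j).B := by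
      exact_mod_cast h2
    refine h3.trans ?_
    gcongr
    refine h1.trans ?_
    have hl : 0 ≤ Real.log (a j + 2) := Real.log_nonneg (by linarith [ha j])
    have hT' : (PSF.cost c (Tj j) : ℝ) ≤ OPT := by exact_mod_cast hTjc j
    change K * (Real.log (a j + 2) * _ + _) ≤ _
    gcongr
  have hasum : ∑ j, a j ≤ min (R.length : ℝ) (Δ : ℝ) := by
    refine le_min ?_ ?_
    · calc ∑ j, a j ≤ ∑ j, ((PSF.timesOf R j).card : ℝ) :=
            Finset.sum_le_sum fun j _ => min_le_left _ _
        _ = R.length := by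
            simp only [PSF.timesOf, Finset.card_map]
            rw [← Nat.cast_sum, ← Finset.card_eq_sum_card_fiberwise
              fun _ _ => Finset.mem_coe.2 (Finset.mem_univ _)]
            simp
    · calc ∑ j, a j ≤ ∑ j, (PSF.outliers R M j + PSF.outliers Rh Mh j : ℝ) :=
            Finset.sum_le_sum fun j _ => min_le_right _ _
        _ = Δ := by
            rw [Finset.sum_add_distrib, ← Nat.cast_sum, ← Nat.cast_sum, PSF.sum_outliers,
              PSF.sum_outliers, ← hΔ]
            push_cast
            rfl
  have hlog : ∑ j, Real.log (a j + 2) ≤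
      b * Real.log (min (R.length : ℝ) (Δ : ℝ) / (b : ℝ) + 2) := by
    refine (PSF.sum_log_le a ha).trans ?_
    have hb : (0 : ℝ) ≤ b := Nat.cast_nonneg b
    have h1 : 0 ≤ (∑ j, a j) / (b : ℝ) := div_nonneg (Finset.sum_nonneg fun j _ => ha j) hb
    have h2 := div_le_div_of_nonneg_right hasum hb
    exact mul_le_mul_of_nonneg_left (Real.log_le_log (by linarith) (by linarith)) hb
  calc (PSF.cost c (Finset.univ.biUnion fun j => (s R.length j).S) : ℝ)
      ≤ ∑ j, (PSF.cost c (s R.length j).S : ℝ) := by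
        exact_mod_cast PSF.cost_biUnion_le c Finset.univ fun j => (s R.length j).S
    _ ≤ ∑ j, (1 + 6 * γ) * (K * (Real.log (a j + 2) * OPT + Dj j)) :=
        Finset.sum_le_sum fun j _ => hcost j
    _ = (1 + 6 * γ) * (K * ((∑ j, Real.log (a j + 2)) * OPT + D)) := by
        rw [← Finset.mul_sum, ← Finset.mul_sum, Finset.sum_add_distrib, Finset.sum_mul, hDsum]
    _ ≤ (1 + 6 * γ) *
          (K * ((b * Real.log (min (R.length : ℝ) (Δ : ℝ) / (b : ℝ) + 2)) * OPT + D)) := by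
        gcongr
    _ = _ := by ring
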